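/- Let $f:\mathbb{R}^d\to\mathbb{R}$ ($d\ge 1$) be twice differentiable and let $\alpha,\gamma,\epsilon,\delta>0$ and $B,\beta,\rho,Q\ge 0$. Call $f$ $(\alpha,\gamma,\epsilon,\delta)$-strict saddle if at every point $w$ at least one of the following holds: (1) $\|\nabla f(w)\|\ge\epsilon$; (2) $\lambda_{\min}(\nabla^2 f(w))\le-\gamma$; (3) there is a local minimum $w^\star$ of $f$ with $\|w-w^\star\|\le\delta$ such that $\lambda_{\min}(\nabla^2 f(w'))\ge\alpha$ whenever $\|w'-w^\star\|\le 2\delta$. A stochastic gradient oracle for $f$ of radius $Q$ assigns to each $w\in\mathbb{R}^d$ a random vector $SG(w)$ with $\mathbb{E}[SG(w)]=\nabla f(w)$ and $\|SG(w)-\nabla f(w)\|\le Q$ almost surely. Noisy Gradient Descent with step size $\eta>0$ and initial point $w_0$ is the iteration $w_{t+1}=w_t-\eta\,(SG(w_t)+n_t)$, where each step uses a fresh independent call of the oracle and an independent vector $n_t$ uniformly distributed on the unit sphere. There are functions $\eta_{\max}>0$, $K$ and $R$ of the parameters $(d,Q,\alpha,\gamma,\epsilon,\delta,B,\beta,\rho)$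 alone, such that $\eta_{\max}$, $1/\eta_{\max}$, $K$ and $R$ are bounded above by polynomials in $Q,1/\alpha,1/\gamma,1/\epsilon,1/\delta,B,\beta,\rho,d$, and such that the following holds. **Theorem.** Suppose that $f$ is $(\alpha,\gamma,\epsilon,\delta)$-strict saddle, $|f(w)|\le B$ for all $w$, $f$ is $\beta$-smooth ($\|\nabla f(w_1)-\nabla f(w_2)\|\le\beta\|w_1-w_2\|$), $f$ has $\rho$-Lipschitz Hessian ($\|\nabla^2 f(w_1)-\nabla^2 f(w_2)\|\le\rho\|w_1-w_2\|$ in spectral norm), and $f$ has a stochastic gradient oracle of radius $Q$. Then for every initial point $w_0$, every $\zeta>0$ and every $0<\eta\le\eta_{\max}/\max\{1,\log(1/\zeta)\}$, after $$T=\left\lceil K\,\eta^{-2}\max\{1,\log(1/\zeta)\}\right\rceil$$ iterations, with probability at least $1-\zeta$ the output $w_T$ of Noisy Gradient Descent satisfies $$\|w_T-w^\star\|\le R\,\sqrt{\eta\log\frac{1}{\eta\zeta}}$$ for some local minimum $w^\star$ of $f$. -/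

import Mathlib

open MeasureTheory ProbabilityTheory

noncomputable section

namespace NoisySGD

section Functions

variable {d : ℕ}

/-- The Hessian of `f` at `w`, as a linear operator: the derivative of the gradient field.
Its operator norm is the spectral norm of the Hessian matrix. -/
def hessian (f : EuclideanSpace ℝ (Fin d) → ℝ) (w : EuclideanSpace ℝ (Fin d)) :
    EuclideanSpace ℝ (Fin d) →L[ℝ] EuclideanSpace ℝ (Fin d) :=
  fderiv ℝ (gradient f) w

/-- `λ_min(H) ≤ c`: some eigenvalue of `H` is at most `c`. -/
def LambdaMinLE (H : EuclideanSpace ℝ (Fin d) →L[ℝ] EuclideanSpace ℝ (Fin d)) (c : ℝ) : Prop :=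
  ∃ lam ≤ c, Module.End.HasEigenvalue
    (H : EuclideanSpace ℝ (Fin d) →ₗ[ℝ] EuclideanSpace ℝ (Fin d)) lam

/-- `λ_min(H) ≥ c`: every eigenvalue of `H` is at least `c`. -/
def LambdaMinGE (H : EuclideanSpace ℝ (Fin d) →L[ℝ] EuclideanSpace ℝ (Fin d)) (c : ℝ) : Prop :=
  ∀ lam, Module.End.HasEigenvalue
    (H : EuclideanSpace ℝ (Fin d) →ₗ[ℝ] EuclideanSpace ℝ (Fin d)) lam → c ≤ lam

/-- `f` is `α`-strongly convex on `s`: the smallest eigenvalue of the Hessian is at least `α`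
at every point of `s`. -/
def StronglyConvexOn (f : EuclideanSpace ℝ (Fin d) → ℝ) (α : ℝ)
    (s : Set (EuclideanSpace ℝ (Fin d))) : Prop :=
  ∀ w ∈ s, LambdaMinGE (hessian f w) α

/-- The gradient of `f` is `β`-Lipschitz. -/
def IsSmooth (f : EuclideanSpace ℝ (Fin d) → ℝ) (β : ℝ) : Prop :=
  ∀ w₁ w₂, ‖gradient f w₁ - gradient f w₂‖ ≤ β * ‖w₁ - w₂‖

/-- The Hessian of `f` is `ρ`-Lipschitz in spectral norm. -/
def HasLipschitzHessian (f : EuclideanSpace ℝ (Fin d) → ℝ) (ρ : ℝ) : Prop :=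
  ∀ w₁ w₂, ‖hessian f w₁ - hessian f w₂‖ ≤ ρ * ‖w₁ - w₂‖

/-- The `(α, γ, ε, δ)`-strict saddle property of a twice differentiable function. -/
structure IsStrictSaddle (f : EuclideanSpace ℝ (Fin d) → ℝ) (α γ ε δ : ℝ) : Prop where
  differentiable : Differentiable ℝ f
  differentiable_gradient : Differentiable ℝ (gradient f)
  trichotomy : ∀ w,
    ε ≤ ‖gradient f w‖ ∨
    LambdaMinLE (hessian f w) (-γ) ∨
    ∃ wstar, IsLocalMin f wstar ∧ ‖w - wstar‖ ≤ δ ∧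
      StronglyConvexOn f α (Metric.closedBall wstar (2 * δ))

/-- `SG` is a stochastic gradient oracle for `f` of radius `Q`: for every point `w`, `SG w` is a
random vector (on the probability space `(S, ν)` of the oracle's internal randomness) with
expectation `∇ f w` and within distance `Q` of it almost surely. -/
structure IsStochasticGradientOracle {S : Type*} [MeasurableSpace S]
    (f : EuclideanSpace ℝ (Fin d) → ℝ)
    (SG : EuclideanSpace ℝ (Fin d) → S → EuclideanSpace ℝ (Fin d))
    (ν : Measure S) (Q : ℝ) : Prop where
  measurable : Measurable (Function.uncurry SG)
  integrable : ∀ w, Integrable (SG w) ν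
  mean : ∀ w, ∫ s, SG w s ∂ν = gradient f w
  radius : ∀ w, ∀ᵐ s ∂ν, ‖SG w s - gradient f w‖ ≤ Q

variable (d) in
/-- The uniform distribution on the unit sphere of `ℝ^d`: normalized surface measure. -/
def uniformSphere : Measure (EuclideanSpace ℝ (Fin d)) :=
  let surface := (volume : Measure (EuclideanSpace ℝ (Fin d))).toSphere
  ((surface Set.univ)⁻¹ • surface).map Subtype.val

/-- The iterates of Noisy Gradient Descent with step size `η` from `w₀`, where the `t`-th step uses
`x t = (s, n)`, the oracle's internal randomness `s` and the artificial noise vector `n`. -/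
def iterate {S : Type*} (η : ℝ)
    (SG : EuclideanSpace ℝ (Fin d) → S → EuclideanSpace ℝ (Fin d))
    (w₀ : EuclideanSpace ℝ (Fin d)) (x : ℕ → S × EuclideanSpace ℝ (Fin d)) :
    ℕ → EuclideanSpace ℝ (Fin d)
  | 0 => w₀
  | t + 1 => iterate η SG w₀ x t - η • (SG (iterate η SG w₀ x t) (x t).1 + (x t).2)

/-- The random inputs `X t = (s_t, n_t)` of the algorithm: all the `s_t` and `n_t` are independent,
`s_t` is a fresh call of the oracle's randomness and `n_t` is uniform on the unit sphere. -/
structure IsAlgorithmRandomness {S Ω : Type*} [MeasurableSpace S] [MeasurableSpace Ω]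
    (ν : Measure S) (P : Measure Ω) (X : ℕ → Ω → S × EuclideanSpace ℝ (Fin d)) : Prop where
  measurable : ∀ t, Measurable (X t)
  indep : iIndepFun X P
  law : ∀ t, P.map (X t) = ν.prod (uniformSphere d)

end Functions

/-- The parameters of the problem (all but the step size and the failure probability). -/
structure Params where
  d : ℕ
  Q : ℝ
  α : ℝ
  γ : ℝ
  ε : ℝ
  δ : ℝ
  B : ℝ
  β : ℝ
  ρ : ℝ

/-- The range of the parameters. -/
structure Params.Valid (p : Params) : Prop where
  d_pos : 0 < p.d
  Q_nonneg : 0 ≤ p.Q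
  α_pos : 0 < p.α
  γ_pos : 0 < p.γ
  ε_pos : 0 < p.ε
  δ_pos : 0 < p.δ
  B_nonneg : 0 ≤ p.B
  β_nonneg : 0 ≤ p.β
  ρ_nonneg : 0 ≤ p.ρ

/-- The quantities in which hidden factors are polynomial:
`Q, 1/α, 1/γ, 1/ε, 1/δ, B, β, ρ, d`. -/
def Params.vec (p : Params) : Fin 9 → ℝ :=
  ![p.Q, 1 / p.α, 1 / p.γ, 1 / p.ε, 1 / p.δ, p.B, p.β, p.ρ, (p.d : ℝ)]

/-- `F = Õ(1)`: `F` is bounded above by a polynomial in `Q, 1/α, 1/γ, 1/ε, 1/δ, B, β, ρ, d`. -/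
def IsOTildeOne (F : Params → ℝ) : Prop :=
  ∃ poly : MvPolynomial (Fin 9) ℝ, ∀ p : Params, p.Valid → F p ≤ MvPolynomial.eval p.vec poly

/-- `F = Θ̃(1)`: `F` is positive, and `F` and `1/F` are both polynomially bounded. -/
def IsThetaTildeOne (F : Params → ℝ) : Prop :=
  (∀ p : Params, p.Valid → 0 < F p) ∧ IsOTildeOne F ∧ IsOTildeOne (fun p => 1 / F p)

end NoisySGD

end

/-!
# Noisy gradient descent converges to local minima of strict saddle functions

All parameters are dominated by one number `W` (`Params.size`, at least `2`), and the step size is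
at most `W⁻¹⁰⁰`. The algorithm is a Markov chain, studied through its transition operator `𝒫` on
functions bounded on balls (`transition`); `𝒫ⁿ φ (w)` is the expectation of `φ` after `n` steps
from `w` (`integral_iterate`). There are three kinds of points.

* *Large gradient*, `|∇f|² ≥ W⁵ η`. By the descent inequality `𝒫 f ≤ f - (η/2) |∇f|² + W η² W²`,
  one step decreases `f` by `η²` in expectation.
* *Negative curvature*, `λ_min(∇²f(w₀)) ≤ -1/W`. The same inequality shows that `f` decreases by
  `η²` per step over `T ∼ W¹⁰/η` steps, provided that `∑_{t<T} E |∇f(w_t)|² ≥ W⁵ η T`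
  (`le_sum_iterate_norm_gradient_sq`). Suppose this sum is smaller. Then the chain moves little,
  `E |w_t - w₀|² = O(η)` (`iterate_dist_sq_le`), so `f` is well approximated by its quadratic
  model at `w₀`. If `v` is a unit eigenvector for an eigenvalue `-γ₀ ≤ -1/W`, the component `y_t`
  along `v` of the gradient of the model satisfies `y_{t+1} = (1 + η γ₀) y_t + η γ₀ ⟨v, ξ_t⟩` up
  to an error of size `η · O(η)` in `L¹`. Noise and expansion make the expectation of the smoothed
  absolute value `√(y² + s²)`, `s ∼ √η`, grow geometrically (`softAbs_growth`); this function is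
  Lipschitz, so an `L¹` bound on the error is enough. Hence `E |∇f(w_t)|` becomes a large multiple
  of `√η`, a contradiction.
* Otherwise the strict saddle property gives a strongly convex minimum, and since the gradient is
  `O(√η)` the point is within `O(√η)` of it: it lies in `nearMin`.

Since `f` is bounded, the total expected time spent before reaching `nearMin` is `O(1/η²)`
(`mul_occupation_le`), so `nearMin` is reached in `O(log(1/ζ)/η²)` steps with probability at least
`1 - ζ/2` (`survival_le_half_pow`). Around a strongly convex minimum `w⋆`, Hoeffding's lemma gives
`𝒫 V ≤ V + 3` for `V(w) = exp(θ |w - w⋆|²)`, `θ ∼ 1/η` (`transition_lyapunov_le`). Started in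
`nearMin`, the chain is therefore at distance more than `r` at time `n` with probability at most
`(V(w) + 3 n) exp(-θ r²)` (`iterate_exit_le`), which is at most `ζ/2` for `r² ∼ η log(1/(ηζ))`.
-/

namespace NoisySGD

set_option linter.unusedSectionVars false

/-! ### The transition operator of a random recursion -/

section Transition

variable {E Ξ : Type*} [NormedAddCommGroup E] [MeasurableSpace E] [MeasurableSpace Ξ]

/-- `φ` is measurable and bounded on every ball. This is the class of test functions on which the
transition operator acts: it contains the continuous functions and is stable under the operator,
so that integrability never has to be discussed again. -/
structure LocBdd (φ : E → ℝ) : Prop where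
  measurable : Measurable φ
  bdd : ∀ r : ℝ, ∃ C : ℝ, ∀ w, ‖w‖ ≤ r → |φ w| ≤ C

/-- The random map `F` is jointly measurable and sends every ball, almost surely, into a ball. -/
structure LocBddStep (μ : Measure Ξ) (F : E → Ξ → E) : Prop where
  measurable : Measurable (Function.uncurry F)
  bdd : ∀ r : ℝ, ∃ r' : ℝ, ∀ w, ‖w‖ ≤ r → ∀ᵐ x ∂μ, ‖F w x‖ ≤ r'

/-- The transition operator of the Markov chain `w ↦ F w x`, `x ∼ μ`. Its `n`-th iterate applied
to `φ`, at `w`, is the expectation of `φ` after `n` steps from `w`. -/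
noncomputable def transition (μ : Measure Ξ) (F : E → Ξ → E) (φ : E → ℝ) (w : E) : ℝ :=
  ∫ x, φ (F w x) ∂μ

theorem LocBdd.of_continuous [ProperSpace E] [BorelSpace E] {φ : E → ℝ} (h : Continuous φ) :
    LocBdd φ where
  measurable := h.measurable
  bdd r := by
    obtain ⟨C, hC⟩ := (isCompact_closedBall (0 : E) r).exists_bound_of_continuousOn h.continuousOn
    exact ⟨C, fun w hw => hC w (by simpa using hw)⟩

theorem LocBdd.of_bounded {φ : E → ℝ} (h : Measurable φ) {C : ℝ} (hC : ∀ w, |φ w| ≤ C) :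
    LocBdd φ :=
  ⟨h, fun _ => ⟨C, fun w _ => hC w⟩⟩

theorem LocBdd.affine {φ ψ : E → ℝ} (hφ : LocBdd φ) (hψ : LocBdd ψ) (a b c : ℝ) :
    LocBdd (fun w => a * φ w + b * ψ w + c) where
  measurable := ((hφ.measurable.const_mul a).add (hψ.measurable.const_mul b)).add_const c
  bdd r := by
    obtain ⟨C, hC⟩ := hφ.bdd r
    obtain ⟨C', hC'⟩ := hψ.bdd r
    refine ⟨|a| * C + |b| * C' + |c|, fun w hw => ?_⟩
    refine (abs_add_three _ _ _).trans ?_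
    rw [abs_mul, abs_mul]
    gcongr
    · exact hC w hw
    · exact hC' w hw

variable {μ : Measure Ξ} [IsProbabilityMeasure μ] {F : E → Ξ → E}

theorem LocBdd.integrable {φ : E → ℝ} (hφ : LocBdd φ) (hF : LocBddStep μ F) (w : E) :
    Integrable (fun x => φ (F w x)) μ := by
  obtain ⟨r', hr'⟩ := hF.bdd ‖w‖
  obtain ⟨C, hC⟩ := hφ.bdd r'
  refine Integrable.of_bound
    (hφ.measurable.comp (hF.measurable.comp measurable_prodMk_left)).aestronglyMeasurable C ?_
  filter_upwards [hr' w le_rfl] with x hx using hC _ hx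

theorem LocBdd.of_transition {φ : E → ℝ} (hφ : LocBdd φ) (hF : LocBddStep μ F) :
    LocBdd (transition μ F φ) where
  measurable := by
    have : StronglyMeasurable (fun p : E × Ξ => φ (F p.1 p.2)) :=
      (hφ.measurable.comp hF.measurable).stronglyMeasurable
    exact this.integral_prod_right.measurable
  bdd r := by
    obtain ⟨r', hr'⟩ := hF.bdd r
    obtain ⟨C, hC⟩ := hφ.bdd r'
    refine ⟨C, fun w hw => ?_⟩
    have := norm_integral_le_of_norm_le_const (μ := μ) (f := fun x => φ (F w x)) (C := C)
      (by filter_upwards [hr' w hw] with x hx using hC _ hx)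
    simpa [transition] using this

theorem transition_mono {φ ψ : E → ℝ} (hF : LocBddStep μ F) (hφ : LocBdd φ) (hψ : LocBdd ψ)
    (h : ∀ w, φ w ≤ ψ w) (w : E) : transition μ F φ w ≤ transition μ F ψ w :=
  integral_mono (hφ.integrable hF w) (hψ.integrable hF w) fun _ => h _

theorem transition_affine {φ ψ : E → ℝ} (hF : LocBddStep μ F) (hφ : LocBdd φ) (hψ : LocBdd ψ)
    (a b c : ℝ) (w : E) :
    transition μ F (fun w => a * φ w + b * ψ w + c) w
      = a * transition μ F φ w + b * transition μ F ψ w + c := by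
  have h1 := (hφ.integrable hF w).const_mul a
  have h2 := (hψ.integrable hF w).const_mul b
  unfold transition
  beta_reduce
  rw [integral_add (f := fun x => a * φ (F w x) + b * ψ (F w x)) (h1.add h2)
    (integrable_const c), integral_add h1 h2, integral_const_mul, integral_const_mul]
  simp

theorem LocBdd.iterate {φ : E → ℝ} (hφ : LocBdd φ) (hF : LocBddStep μ F) (n : ℕ) :
    LocBdd ((transition μ F)^[n] φ) := by
  induction n with
  | zero => exact hφ
  | succ n ih => rw [Function.iterate_succ_apply']; exact ih.of_transition hF

theorem iterate_mono {φ ψ : E → ℝ} (hF : LocBddStep μ F) (hφ : LocBdd φ) (hψ : LocBdd ψ)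
    (h : ∀ w, φ w ≤ ψ w) (n : ℕ) (w : E) :
    (transition μ F)^[n] φ w ≤ (transition μ F)^[n] ψ w := by
  induction n generalizing w with
  | zero => exact h w
  | succ n ih =>
    rw [Function.iterate_succ_apply', Function.iterate_succ_apply']
    exact transition_mono hF (hφ.iterate hF n) (hψ.iterate hF n) ih w

theorem iterate_affine {φ ψ : E → ℝ} (hF : LocBddStep μ F) (hφ : LocBdd φ) (hψ : LocBdd ψ)
    (a b c : ℝ) (n : ℕ) (w : E) :
    (transition μ F)^[n] (fun w => a * φ w + b * ψ w + c) w
      = a * (transition μ F)^[n] φ w + b * (transition μ F)^[n] ψ w + c := by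
  induction n generalizing w with
  | zero => rfl
  | succ n ih =>
    simp only [Function.iterate_succ_apply']
    rw [show (transition μ F)^[n] (fun w => a * φ w + b * ψ w + c)
      = fun w => a * (transition μ F)^[n] φ w + b * (transition μ F)^[n] ψ w + c from funext ih]
    exact transition_affine hF (hφ.iterate hF n) (hψ.iterate hF n) a b c w

/-- A one-step bound `𝒫 χ ≤ a φ + b ψ + c` holds in expectation at any later time. -/
theorem iterate_succ_le {χ φ ψ : E → ℝ} (hF : LocBddStep μ F) (hχ : LocBdd χ) (hφ : LocBdd φ)
    (hψ : LocBdd ψ) {a b c : ℝ} (h : ∀ w, transition μ F χ w ≤ a * φ w + b * ψ w + c)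
    (n : ℕ) (w : E) :
    (transition μ F)^[n + 1] χ w
      ≤ a * (transition μ F)^[n] φ w + b * (transition μ F)^[n] ψ w + c := by
  rw [Function.iterate_succ_apply, ← iterate_affine hF hφ hψ]
  exact iterate_mono hF (hχ.of_transition hF) (hφ.affine hψ a b c) h n w

theorem iterate_const (c : ℝ) (n : ℕ) (w : E) :
    (transition μ F)^[n] (fun _ => c) w = c := by
  induction n generalizing w with
  | zero => rfl
  | succ n ih =>
    rw [Function.iterate_succ_apply', show (transition μ F)^[n] (fun _ => c) = fun _ => c from
      funext ih]
    simp [transition]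

end Transition

/-! ### Gradient steps perturbed by centred noise -/

section Noise

variable {E Ξ : Type*} [NormedAddCommGroup E] [InnerProductSpace ℝ E] [MeasurableSpace E]
  [MeasurableSpace Ξ]

/-- The noise `ξ w x`, `x ∼ μ`, at the point `w` is centred, bounded by `W`, and has variance at
least `1 / W` in every direction. -/
structure IsNoise (μ : Measure Ξ) (ξ : E → Ξ → E) (W : ℝ) : Prop where
  measurable : Measurable (Function.uncurry ξ)
  mean : ∀ w, ∫ x, ξ w x ∂μ = 0
  bound : ∀ w, ∀ᵐ x ∂μ, ‖ξ w x‖ ≤ W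
  variance : ∀ w v, ‖v‖ = 1 → 1 / W ≤ ∫ x, (inner ℝ v (ξ w x)) ^ 2 ∂μ

/-- A step of size `η` along the vector field `-(g + ξ)`. -/
def noisyStep (η : ℝ) (g : E → E) (ξ : E → Ξ → E) (w : E) (x : Ξ) : E :=
  w - η • (g w + ξ w x)

variable [BorelSpace E] [FiniteDimensional ℝ E] {μ : Measure Ξ} [IsProbabilityMeasure μ]
  {ξ : E → Ξ → E} {W : ℝ}

theorem IsNoise.measurable_apply (h : IsNoise μ ξ W) (w : E) : Measurable (ξ w) :=
  h.measurable.comp measurable_prodMk_left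

theorem IsNoise.integrable (h : IsNoise μ ξ W) (w : E) : Integrable (ξ w) μ :=
  Integrable.of_bound (h.measurable_apply w).aestronglyMeasurable W (h.bound w)

theorem IsNoise.abs_inner_le (h : IsNoise μ ξ W) (w v : E) :
    ∀ᵐ x ∂μ, |inner ℝ v (ξ w x)| ≤ ‖v‖ * W := by
  filter_upwards [h.bound w] with x hx
  exact (abs_real_inner_le_norm _ _).trans (by gcongr)

theorem IsNoise.measurable_inner (h : IsNoise μ ξ W) (w v : E) :
    Measurable (fun x => inner ℝ v (ξ w x)) :=
  (measurable_const).inner (h.measurable_apply w)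

theorem IsNoise.integrable_inner (h : IsNoise μ ξ W) (w v : E) :
    Integrable (fun x => inner ℝ v (ξ w x)) μ :=
  Integrable.of_bound (h.measurable_inner w v).aestronglyMeasurable _ (h.abs_inner_le w v)

theorem IsNoise.integral_inner_eq_zero (h : IsNoise μ ξ W) (w v : E) :
    ∫ x, inner ℝ v (ξ w x) ∂μ = 0 := by
  rw [integral_inner (h.integrable w), h.mean, inner_zero_right]

theorem IsNoise.locBddStep (h : IsNoise μ ξ W) {g : E → E} (hg : Continuous g) (η : ℝ) :
    LocBddStep μ (noisyStep η g ξ) where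
  measurable := by
    have : Measurable (fun p : E × Ξ => p.1 - η • (g p.1 + ξ p.1 p.2)) := by
      have h1 := h.measurable
      have h2 := hg.measurable
      exact measurable_fst.sub (((h2.comp measurable_fst).add h1).const_smul η)
    exact this
  bdd r := by
    obtain ⟨C, hC⟩ := (isCompact_closedBall (0 : E) r).exists_bound_of_continuousOn hg.continuousOn
    refine ⟨r + |η| * (C + W), fun w hw => ?_⟩
    filter_upwards [h.bound w] with x hx
    refine (norm_sub_le _ _).trans ?_
    rw [norm_smul, Real.norm_eq_abs]
    gcongr
    exact (norm_add_le _ _).trans (add_le_add (hC w (by simpa using hw)) hx)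

/-- Since the noise is centred, `E |a - ηξ|² = |a|² + η² E |ξ|² ≤ |a|² + η² W²`. -/
theorem IsNoise.integral_norm_sub_sq_le (h : IsNoise μ ξ W) (w a : E) (η : ℝ) :
    ∫ x, ‖a - η • ξ w x‖ ^ 2 ∂μ ≤ ‖a‖ ^ 2 + η ^ 2 * W ^ 2 := by
  have h1 : ∀ᵐ x ∂μ, ‖a - η • ξ w x‖ ^ 2
      ≤ (‖a‖ ^ 2 + η ^ 2 * W ^ 2) + (-(2 * η)) * inner ℝ a (ξ w x) := by
    filter_upwards [h.bound w] with x hx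
    rw [norm_sub_sq_real, inner_smul_right, norm_smul, mul_pow, Real.norm_eq_abs, sq_abs]
    have : ‖ξ w x‖ ^ 2 ≤ W ^ 2 := by gcongr
    nlinarith [mul_le_mul_of_nonneg_left this (sq_nonneg η)]
  have hi := (h.integrable_inner w a).const_mul (-(2 * η))
  calc _ ≤ ∫ x, (‖a‖ ^ 2 + η ^ 2 * W ^ 2) + (-(2 * η)) * inner ℝ a (ξ w x) ∂μ := by
        refine integral_mono_of_nonneg (.of_forall fun _ => by positivity)
          ((integrable_const _).add hi) h1
    _ = _ := by
        rw [integral_add (integrable_const _) hi, integral_const_mul, h.integral_inner_eq_zero]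
        simp

end Noise

/-! ### Smooth functions and their Hessians -/

section Analysis

variable {d : ℕ} {f : EuclideanSpace ℝ (Fin d) → ℝ}

/-- A first order Taylor bound: a map with `L`-Lipschitz derivative is within `L |u|²` of its
linearization. -/
theorem norm_taylor_le {F : Type*} [NormedAddCommGroup F] [NormedSpace ℝ F]
    {φ : EuclideanSpace ℝ (Fin d) → F} (hφ : Differentiable ℝ φ) {L : ℝ} (hL : 0 ≤ L)
    (h : ∀ x y, ‖fderiv ℝ φ x - fderiv ℝ φ y‖ ≤ L * ‖x - y‖) (w u : EuclideanSpace ℝ (Fin d)) :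
    ‖φ (w + u) - φ w - fderiv ℝ φ w u‖ ≤ L * ‖u‖ ^ 2 := by
  have key := (convex_closedBall w ‖u‖).norm_image_sub_le_of_norm_hasFDerivWithin_le'
    (f := φ) (f' := fderiv ℝ φ) (φ := fderiv ℝ φ w) (C := L * ‖u‖) (x := w) (y := w + u)
    (fun x _ => (hφ x).hasFDerivAt.hasFDerivWithinAt)
    (fun x hx => (h x w).trans (by
      rw [mem_closedBall_iff_norm] at hx
      gcongr))
    (by simp) (by simp)
  simpa [pow_two, mul_assoc] using key

theorem fderiv_eq_inner_gradient (w u : EuclideanSpace ℝ (Fin d)) :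
    fderiv ℝ f w u = inner ℝ (gradient f w) u := by
  rw [gradient, InnerProductSpace.toDual_symm_apply]

theorem abs_sub_sub_inner_gradient_le (hf : Differentiable ℝ f) {β : ℝ} (hβ : 0 ≤ β)
    (h : IsSmooth f β) (w u : EuclideanSpace ℝ (Fin d)) :
    |f (w + u) - f w - inner ℝ (gradient f w) u| ≤ β * ‖u‖ ^ 2 := by
  rw [← fderiv_eq_inner_gradient]
  refine norm_taylor_le hf hβ (fun x y => ?_) w u
  have := h x y
  rwa [gradient, gradient, ← map_sub, LinearIsometryEquiv.norm_map] at this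

theorem norm_gradient_sub_sub_hessian_le (hf : Differentiable ℝ (gradient f)) {ρ : ℝ} (hρ : 0 ≤ ρ)
    (h : HasLipschitzHessian f ρ) (w u : EuclideanSpace ℝ (Fin d)) :
    ‖gradient f (w + u) - gradient f w - hessian f w u‖ ≤ ρ * ‖u‖ ^ 2 :=
  norm_taylor_le hf hρ h w u

theorem hessian_symm (hf : Differentiable ℝ f) (hf' : Differentiable ℝ (gradient f))
    (w u v : EuclideanSpace ℝ (Fin d)) :
    inner ℝ (hessian f w u) v = inner ℝ u (hessian f w v) := by
  let D : EuclideanSpace ℝ (Fin d) →L[ℝ] EuclideanSpace ℝ (Fin d) →L[ℝ] ℝ :=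
    LinearMap.toContinuousLinearMap
      { toFun := fun x => innerSL ℝ x
        map_add' := fun x y => map_add _ x y
        map_smul' := fun c x => by ext y; simp }
  have hD : ∀ x y, D x y = inner ℝ x y := fun _ _ => rfl
  have h1 : ∀ y, HasFDerivAt f (D (gradient f y)) y := fun y => by
    have : D (gradient f y) = fderiv ℝ f y := by
      ext u; rw [hD, fderiv_eq_inner_gradient]
    rw [this]; exact (hf y).hasFDerivAt
  have h2 : HasFDerivAt (fun y => D (gradient f y)) (D.comp (hessian f w)) w :=
    D.hasFDerivAt.comp w (hf' w).hasFDerivAt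
  have := second_derivative_symmetric h1 h2 u v
  rw [ContinuousLinearMap.comp_apply, ContinuousLinearMap.comp_apply, hD, hD] at this
  rw [this, real_inner_comm]

/-- A symmetric operator whose eigenvalues are all at least `c` satisfies `c |u|² ≤ ⟨u, H u⟩`. -/
theorem LambdaMinGE.le_inner {H : EuclideanSpace ℝ (Fin d) →L[ℝ] EuclideanSpace ℝ (Fin d)}
    {c : ℝ} (h : LambdaMinGE H c)
    (hH : ∀ u v, inner ℝ (H u) v = inner ℝ u (H v)) (u : EuclideanSpace ℝ (Fin d)) :
    c * ‖u‖ ^ 2 ≤ inner ℝ (H u) u := by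
  have hs : (H : EuclideanSpace ℝ (Fin d) →ₗ[ℝ] EuclideanSpace ℝ (Fin d)).IsSymmetric := hH
  let b := hs.eigenvectorBasis (n := d) (by simp)
  have hb : ∀ i, inner ℝ (H u) (b i) = hs.eigenvalues (by simp) i * inner ℝ u (b i) := fun i => by
    rw [hH]
    have : H (b i) = hs.eigenvalues (n := d) (by simp) i • b i := by
      exact hs.apply_eigenvectorBasis (n := d) (by simp) i
    rw [this, inner_smul_right]
  rw [← b.sum_inner_mul_inner (H u) u, ← b.sum_sq_norm_inner_left u, Finset.mul_sum]
  refine Finset.sum_le_sum fun i _ => ?_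
  rw [hb, real_inner_comm u (b i), Real.norm_eq_abs, sq_abs]
  have : c ≤ hs.eigenvalues (n := d) (by simp) i :=
    h _ (by simpa using hs.hasEigenvalue_eigenvalues (n := d) (by simp) i)
  nlinarith [mul_le_mul_of_nonneg_right this (sq_nonneg (inner ℝ u (b i)))]

theorem gradient_eq_zero_of_isLocalMin {w : EuclideanSpace ℝ (Fin d)} (h : IsLocalMin f w) :
    gradient f w = 0 := by
  rw [gradient, h.fderiv_eq_zero, map_zero]

/-- The gradient of a strongly convex function is strongly monotone; stated from a minimizer. -/
theorem StronglyConvexOn.le_inner_gradient (hf : Differentiable ℝ f)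
    (hf' : Differentiable ℝ (gradient f)) {c r : ℝ} {wstar w : EuclideanSpace ℝ (Fin d)}
    (h : StronglyConvexOn f c (Metric.closedBall wstar r)) (hmin : IsLocalMin f wstar)
    (hw : ‖w - wstar‖ ≤ r) :
    c * ‖w - wstar‖ ^ 2 ≤ inner ℝ (gradient f w) (w - wstar) := by
  set z := w - wstar with hz
  let φ : ℝ → ℝ := fun t => inner ℝ (gradient f (wstar + t • z)) z
  have hd : ∀ t, HasDerivAt φ (inner ℝ (hessian f (wstar + t • z) z) z) t := fun t => by
    have h1 : HasDerivAt (fun t : ℝ => wstar + t • z) z t := by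
      simpa using ((hasDerivAt_id t).smul_const z).const_add wstar
    have h2 := (hf' (wstar + t • z)).hasFDerivAt.comp_hasDerivAt t h1
    simpa [φ, hessian] using h2.inner ℝ (hasDerivAt_const t z)
  obtain ⟨t, ht, hts⟩ := exists_hasDerivAt_eq_slope φ _ (zero_lt_one' ℝ)
    (fun t _ => (hd t).continuousAt.continuousWithinAt) (fun t _ => hd t)
  have h0 : φ 0 = 0 := by
    simp only [φ, zero_smul, add_zero, gradient_eq_zero_of_isLocalMin hmin, inner_zero_left]
  have h1 : φ 1 = inner ℝ (gradient f w) z := by simp [φ, hz]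
  have hm : wstar + t • z ∈ Metric.closedBall wstar r := by
    rw [mem_closedBall_iff_norm, add_sub_cancel_left, norm_smul, Real.norm_eq_abs,
      abs_of_pos ht.1]
    nlinarith [norm_nonneg z, ht.2]
  have := (h _ hm).le_inner (hessian_symm hf hf' _) z
  rw [hts, h0, h1] at this
  simpa using this

/-- A direction of negative curvature: a unit eigenvector for an eigenvalue `-γ₀ ≤ -γ`. -/
theorem LambdaMinLE.exists_unit {H : EuclideanSpace ℝ (Fin d) →L[ℝ] EuclideanSpace ℝ (Fin d)}
    {γ : ℝ} (h : LambdaMinLE H (-γ)) : ∃ γ₀ v, γ ≤ γ₀ ∧ ‖v‖ = 1 ∧ H v = -(γ₀ • v) := by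
  obtain ⟨l, hl, he⟩ := h
  obtain ⟨v, hv⟩ := he.exists_hasEigenvector
  have hn : ‖v‖ ≠ 0 := norm_ne_zero_iff.mpr hv.2
  have hHv : H v = l • v := hv.apply_eq_smul
  refine ⟨-l, ‖v‖⁻¹ • v, by linarith, ?_, ?_⟩
  · rw [norm_smul, norm_inv, norm_norm, inv_mul_cancel₀ hn]
  · rw [map_smul, hHv, neg_smul, neg_neg, smul_comm]

theorem norm_hessian_apply_le {β : ℝ} (hβ : 0 ≤ β) (h : IsSmooth f β)
    (w v : EuclideanSpace ℝ (Fin d)) : ‖hessian f w v‖ ≤ β * ‖v‖ := by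
  have hl : LipschitzWith ⟨β, hβ⟩ (gradient f) :=
    LipschitzWith.of_dist_le_mul fun x y => by rw [dist_eq_norm, dist_eq_norm]; exact h x y
  have := norm_fderiv_le_of_lipschitz ℝ hl (x₀ := w)
  exact (ContinuousLinearMap.le_opNorm _ _).trans (by gcongr; exact this)

end Analysis

/-! ### Expected decrease of the objective in one step -/

section Descent

variable {d : ℕ} {f : EuclideanSpace ℝ (Fin d) → ℝ} {Ξ : Type*} [MeasurableSpace Ξ]
  {μ : Measure Ξ} [IsProbabilityMeasure μ]
  {ξ : EuclideanSpace ℝ (Fin d) → Ξ → EuclideanSpace ℝ (Fin d)} {W η β : ℝ}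

/-- The descent inequality, in expectation over one step. -/
theorem transition_objective_le (hξ : IsNoise μ ξ W) (hf : Differentiable ℝ f)
    (hf' : Differentiable ℝ (gradient f)) (hβ : 0 ≤ β) (h : IsSmooth f β) (hη : 0 ≤ η)
    (hηβ : η * β ≤ 1 / 2) (w : EuclideanSpace ℝ (Fin d)) :
    transition μ (noisyStep η (gradient f) ξ) f w
      ≤ f w - η / 2 * ‖gradient f w‖ ^ 2 + β * η ^ 2 * W ^ 2 := by
  have hstep := hξ.locBddStep hf'.continuous η
  set g := gradient f w with hg
  have hpt : ∀ x, f (noisyStep η (gradient f) ξ w x)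
      ≤ (f w - η * ‖g‖ ^ 2) + (-η) * inner ℝ g (ξ w x) + β * ‖(-η) • g - η • ξ w x‖ ^ 2 := by
    intro x
    have h1 := abs_sub_sub_inner_gradient_le hf hβ h w ((-η) • g - η • ξ w x)
    have h2 : w + ((-η) • g - η • ξ w x) = noisyStep η (gradient f) ξ w x := by
      rw [noisyStep, ← hg]; module
    rw [h2, inner_sub_right, inner_smul_right, inner_smul_right, ← hg,
      real_inner_self_eq_norm_sq] at h1
    linarith [(abs_le.mp h1).2]
  have i1 := (hξ.integrable_inner w g).const_mul (-η)
  have i2 : Integrable (fun x => β * ‖(-η) • g - η • ξ w x‖ ^ 2) μ := by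
    refine Integrable.const_mul ?_ β
    refine Integrable.of_bound (C := (η * ‖g‖ + η * W) ^ 2) ?_ ?_
    · exact ((measurable_const.sub ((hξ.measurable_apply w).const_smul η)).norm.pow_const
        2).aestronglyMeasurable
    · filter_upwards [hξ.bound w] with x hx
      rw [Real.norm_eq_abs, abs_of_nonneg (by positivity)]
      gcongr
      refine (norm_sub_le _ _).trans ?_
      rw [norm_smul, norm_smul, norm_neg, Real.norm_of_nonneg hη]
      gcongr
  have h3 := hξ.integral_norm_sub_sq_le w ((-η) • g) η
  have hle : _ ≤ ∫ x, ((f w - η * ‖g‖ ^ 2) + (-η) * inner ℝ g (ξ w x)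
      + β * ‖(-η) • g - η • ξ w x‖ ^ 2) ∂μ :=
    integral_mono ((LocBdd.of_continuous hf.continuous).integrable hstep w)
    (((integrable_const (f w - η * ‖g‖ ^ 2)).add i1).add i2) hpt
  rw [integral_add (f := fun x => (f w - η * ‖g‖ ^ 2) + (-η) * inner ℝ g (ξ w x))
      ((integrable_const _).add i1) i2, integral_add (integrable_const _) i1,
    integral_const_mul, integral_const_mul, hξ.integral_inner_eq_zero] at hle
  simp only [integral_const, probReal_univ, one_smul, mul_zero, add_zero] at hle
  rw [norm_smul, norm_neg, Real.norm_of_nonneg hη, mul_pow] at h3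
  refine hle.trans ?_
  have := mul_le_mul_of_nonneg_left h3 hβ
  have h4 : η * β * (η * ‖g‖ ^ 2) ≤ 1 / 2 * (η * ‖g‖ ^ 2) := by gcongr
  nlinarith

/-- A one-step decrease of order `η²` wherever `|∇f|²` exceeds the noise level. -/
theorem transition_objective_le_of_large_gradient (hξ : IsNoise μ ξ W) (hf : Differentiable ℝ f)
    (hf' : Differentiable ℝ (gradient f)) (hβ : 0 ≤ β) (h : IsSmooth f β) (hη : 0 ≤ η)
    (hηβ : η * β ≤ 1 / 2) {D : ℝ} (hD : 2 * β * W ^ 2 + 2 ≤ D) {w : EuclideanSpace ℝ (Fin d)}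
    (hw : D * η ≤ ‖gradient f w‖ ^ 2) :
    transition μ (noisyStep η (gradient f) ξ) f w ≤ f w - η ^ 2 := by
  have := transition_objective_le hξ hf hf' hβ h hη hηβ w
  nlinarith [mul_le_mul_of_nonneg_left hw hη, mul_le_mul_of_nonneg_right hD (sq_nonneg η)]

/-- If the accumulated squared gradients exceed the noise level on average over `n` steps, the
objective decreases by `n η²` in expectation. -/
theorem iterate_objective_le_of_large_sum (hξ : IsNoise μ ξ W) (hf : Differentiable ℝ f)
    (hf' : Differentiable ℝ (gradient f)) (hβ : 0 ≤ β) (h : IsSmooth f β) (hη : 0 ≤ η)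
    (hηβ : η * β ≤ 1 / 2) {D : ℝ} (hD : 2 * β * W ^ 2 + 2 ≤ D) {w : EuclideanSpace ℝ (Fin d)}
    {n : ℕ} (hw : D * η * n ≤ ∑ k ∈ Finset.range n,
      (transition μ (noisyStep η (gradient f) ξ))^[k] (fun w => ‖gradient f w‖ ^ 2) w) :
    (transition μ (noisyStep η (gradient f) ξ))^[n] f w ≤ f w - η ^ 2 * n := by
  have hstep := hξ.locBddStep hf'.continuous η
  have hsum : ∀ m : ℕ, (transition μ (noisyStep η (gradient f) ξ))^[m] f w
      ≤ f w - η / 2 * ∑ k ∈ Finset.range m,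
        (transition μ (noisyStep η (gradient f) ξ))^[k] (fun w => ‖gradient f w‖ ^ 2) w
        + m * (β * η ^ 2 * W ^ 2) := by
    intro m
    induction m with
    | zero => simp
    | succ m ih =>
      have := iterate_succ_le (a := 1) (b := -(η / 2)) (c := β * η ^ 2 * W ^ 2) hstep
        (LocBdd.of_continuous hf.continuous) (LocBdd.of_continuous hf.continuous)
        (LocBdd.of_continuous (φ := fun w => ‖gradient f w‖ ^ 2) (hf'.continuous.norm.pow 2))
        (fun w => by
          have := transition_objective_le hξ hf hf' hβ h hη hηβ w
          linarith) m w
      rw [Finset.sum_range_succ]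
      push_cast
      linarith
  have h1 := hsum n
  have h2 := mul_le_mul_of_nonneg_left hw hη
  have h3 := mul_le_mul_of_nonneg_right hD (mul_nonneg (sq_nonneg η) n.cast_nonneg)
  linarith

end Descent

/-! ### Growth of a smoothed absolute value under expansion and noise -/

section SoftAbs

/-- A smooth approximation of `|y|` at scale `s`. It is `1`-Lipschitz, so that it tolerates errors
which are only controlled in `L¹`, and strictly convex near `0`, so that noise makes it grow. -/
noncomputable def softAbs (s y : ℝ) : ℝ := √(y ^ 2 + s ^ 2)

variable {s : ℝ}

theorem softAbs_sq (s y : ℝ) : softAbs s y ^ 2 = y ^ 2 + s ^ 2 := Real.sq_sqrt (by positivity)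

theorem softAbs_nonneg (s y : ℝ) : 0 ≤ softAbs s y := Real.sqrt_nonneg _

theorem le_softAbs (s y : ℝ) : s ≤ softAbs s y :=
  Real.le_sqrt_of_sq_le (by nlinarith [sq_nonneg y])

theorem abs_le_softAbs (s y : ℝ) : |y| ≤ softAbs s y :=
  Real.le_sqrt_of_sq_le (by rw [sq_abs]; nlinarith [sq_nonneg s])

theorem softAbs_le (hs : 0 ≤ s) (y : ℝ) : softAbs s y ≤ |y| + s :=
  Real.sqrt_le_iff.mpr ⟨by positivity, by nlinarith [sq_abs y, abs_nonneg y]⟩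

theorem softAbs_le_add (s a b : ℝ) : softAbs s a ≤ softAbs s b + |a - b| := by
  refine Real.sqrt_le_iff.mpr ⟨add_nonneg (softAbs_nonneg s b) (abs_nonneg _), ?_⟩
  have h1 := mul_le_mul_of_nonneg_right (abs_le_softAbs s b) (abs_nonneg (a - b))
  have h2 := le_abs_self (b * (a - b))
  rw [abs_mul] at h2
  nlinarith [softAbs_sq s b, sq_abs (a - b)]

/-- A second order lower Taylor bound for `softAbs`. With `p`, `q` the values at `z`, `z + b`, it
comes from the identity
`8 q p³ = 8 p⁴ + 8 p² z b + 4 s² b² - 4 z b³ - b⁴ + (q - p)³ (q + 3 p)`. -/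
theorem le_softAbs_add (hs : 0 < s) {z b c : ℝ} (hb : |b| ≤ c) (hc : c ≤ s) :
    softAbs s z + z / softAbs s z * b + s ^ 2 / (2 * softAbs s z ^ 3) * b ^ 2 - 2 * c ^ 3 / s ^ 2
      ≤ softAbs s (z + b) := by
  set p := softAbs s z with hp
  set q := softAbs s (z + b) with hq
  have hps : s ≤ p := le_softAbs s z
  have hpp : 0 < p := hs.trans_le hps
  have hqq : 0 ≤ q := softAbs_nonneg _ _
  have hp2 : p ^ 2 = z ^ 2 + s ^ 2 := softAbs_sq s z
  have hq2 : q ^ 2 = (z + b) ^ 2 + s ^ 2 := softAbs_sq s (z + b)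
  have hc0 : 0 ≤ c := (abs_nonneg b).trans hb
  have hpq : p - q ≤ c := by
    have := softAbs_le_add s z (z + b)
    rw [sub_add_cancel_left, abs_neg] at this
    linarith
  have hid : 8 * (q * p ^ 3) = 8 * p ^ 4 + 8 * p ^ 2 * (z * b) + 4 * s ^ 2 * b ^ 2 - 4 * (z * b ^ 3)
      - b ^ 4 + (q - p) ^ 3 * (q + 3 * p) := by
    have e1 : (q ^ 2) ^ 2 = ((z + b) ^ 2 + s ^ 2) ^ 2 := by rw [hq2]
    have e2 : (p ^ 2) ^ 2 = (z ^ 2 + s ^ 2) ^ 2 := by rw [hp2]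
    have e3 : q ^ 2 * p ^ 2 = ((z + b) ^ 2 + s ^ 2) * (z ^ 2 + s ^ 2) := by rw [hp2, hq2]
    have e4 : p ^ 2 * (z * b) = (z ^ 2 + s ^ 2) * (z * b) := by rw [hp2]
    linear_combination 6 * e3 - e1 - 5 * e2 - 8 * e4
  have hz : |z| ≤ p := abs_le_softAbs s z
  have hb3 : |b| ^ 3 ≤ c ^ 3 := by gcongr
  have t1 : z * b ^ 3 ≤ p * c ^ 3 := by
    refine (le_abs_self _).trans ?_
    rw [abs_mul, abs_pow]
    gcongr
  have t2 : b ^ 4 ≤ p * c ^ 3 := by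
    rw [← abs_of_nonneg (show 0 ≤ b ^ 4 by positivity), abs_pow, pow_succ, mul_comm]
    gcongr
    linarith
  have t3 : -(4 * (p * c ^ 3)) ≤ (q - p) ^ 3 * (q + 3 * p) := by
    rcases le_total p q with h | h
    · have : 0 ≤ (q - p) ^ 3 * (q + 3 * p) :=
        mul_nonneg (pow_nonneg (by linarith) _) (by linarith)
      have : 0 ≤ p * c ^ 3 := by positivity
      linarith
    · have h1 : (p - q) ^ 3 ≤ c ^ 3 := pow_le_pow_left₀ (by linarith) hpq 3
      have h2 : (p - q) ^ 3 * (q + 3 * p) ≤ c ^ 3 * (4 * p) :=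
        mul_le_mul h1 (by linarith) (by linarith) (by positivity)
      nlinarith
  have hmain : p + z / p * b + s ^ 2 / (2 * p ^ 3) * b ^ 2 - 2 * c ^ 3 / p ^ 2 ≤ q := by
    have : p + z / p * b + s ^ 2 / (2 * p ^ 3) * b ^ 2 - 2 * c ^ 3 / p ^ 2
        = (8 * p ^ 4 + 8 * p ^ 2 * (z * b) + 4 * s ^ 2 * b ^ 2 - 16 * (p * c ^ 3))
          / (8 * p ^ 3) := by
      field_simp
      ring
    rw [this, div_le_iff₀ (by positivity)]
    have : 0 ≤ p * c ^ 3 := by positivity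
    linarith
  have : 2 * c ^ 3 / p ^ 2 ≤ 2 * c ^ 3 / s ^ 2 := by gcongr
  linarith

theorem continuous_softAbs (s : ℝ) : Continuous (softAbs s) :=
  Real.continuous_sqrt.comp (by fun_prop)

/-- Centred noise of size `x` increases the expected value of `softAbs` by its second order term. -/
theorem le_integral_softAbs {Ξ : Type*} [MeasurableSpace Ξ] {μ : Measure Ξ}
    [IsProbabilityMeasure μ] {X : Ξ → ℝ} {W : ℝ} (hX : Measurable X) (hXW : ∀ᵐ a ∂μ, |X a| ≤ W)
    (h0 : ∫ a, X a ∂μ = 0) (h2 : 1 / W ≤ ∫ a, X a ^ 2 ∂μ) (hs : 0 < s) {x : ℝ}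
    (hx : 0 ≤ x) (hxW : x * W ≤ s) (z : ℝ) :
    softAbs s z + s ^ 2 * x ^ 2 / (2 * W * softAbs s z ^ 3) - 2 * (x * W) ^ 3 / s ^ 2
      ≤ ∫ a, softAbs s (z + x * X a) ∂μ := by
  set p := softAbs s z with hp
  have hpp : 0 < p := hs.trans_le (le_softAbs s z)
  have i1 : Integrable X μ := Integrable.of_bound hX.aestronglyMeasurable W hXW
  have i2 : Integrable (fun a => X a ^ 2) μ := by
    refine Integrable.of_bound (C := W ^ 2) (hX.pow_const 2).aestronglyMeasurable ?_
    filter_upwards [hXW] with a ha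
    rw [norm_pow, Real.norm_eq_abs]
    gcongr
  have hb : ∀ᵐ a ∂μ, |x * X a| ≤ x * W := by
    filter_upwards [hXW] with a ha
    rw [abs_mul, abs_of_nonneg hx]
    gcongr
  have i3 : Integrable (fun a => softAbs s (z + x * X a)) μ := by
    refine Integrable.of_bound (C := |z| + x * W + s) ?_ ?_
    · exact ((continuous_softAbs s).measurable.comp
        ((hX.const_mul x).const_add z)).aestronglyMeasurable
    · filter_upwards [hb] with a ha
      rw [Real.norm_of_nonneg (softAbs_nonneg _ _)]
      refine (softAbs_le hs.le _).trans ?_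
      linarith [abs_add_le z (x * X a)]
  have hpt : ∀ᵐ a ∂μ, (p - 2 * (x * W) ^ 3 / s ^ 2) + (z / p * x) * X a
      + (s ^ 2 / (2 * p ^ 3) * x ^ 2) * X a ^ 2 ≤ softAbs s (z + x * X a) := by
    filter_upwards [hb] with a ha
    have := le_softAbs_add hs (z := z) ha hxW
    rw [mul_pow] at this
    linarith
  have hle := integral_mono_ae (((integrable_const (p - 2 * (x * W) ^ 3 / s ^ 2)).add
    (i1.const_mul (z / p * x))).add (i2.const_mul (s ^ 2 / (2 * p ^ 3) * x ^ 2))) i3 hpt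
  have e : ∫ a, ((p - 2 * (x * W) ^ 3 / s ^ 2) + (z / p * x) * X a
      + (s ^ 2 / (2 * p ^ 3) * x ^ 2) * X a ^ 2) ∂μ
      = (p - 2 * (x * W) ^ 3 / s ^ 2) + (s ^ 2 / (2 * p ^ 3) * x ^ 2) * ∫ a, X a ^ 2 ∂μ := by
    rw [integral_add (f := fun a => (p - 2 * (x * W) ^ 3 / s ^ 2) + (z / p * x) * X a)
      ((integrable_const _).add (i1.const_mul _)) (i2.const_mul _),
      integral_add (integrable_const _) (i1.const_mul _), integral_const_mul, integral_const_mul,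
      h0]
    simp
  refine le_trans ?_ (e.symm.trans_le hle)
  have := mul_le_mul_of_nonneg_left h2 (show 0 ≤ s ^ 2 / (2 * p ^ 3) * x ^ 2 by positivity)
  have e2 : s ^ 2 / (2 * p ^ 3) * x ^ 2 * (1 / W) = s ^ 2 * x ^ 2 / (2 * W * p ^ 3) := by
    ring
  linarith

/-- Expansion by `1 + x` together with noise of size `x` increases `softAbs` by a factor `1 + x/3`,
up to a small error: far from `0` by the expansion, near `0` by the noise. -/
theorem softAbs_growth (hs : 0 < s) {x W : ℝ} (hx : 0 < x) (hx1 : x ≤ 1) (hW : 0 < W)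
    (hsx : s ^ 2 ≤ x / (12 * W)) (hxs : 48 * (x ^ 2 * W ^ 3) ≤ s ^ 3) (y : ℝ) :
    (1 + x / 3) * softAbs s y - x * s / 24
      ≤ softAbs s ((1 + x) * y)
        + s ^ 2 * x ^ 2 / (2 * W * softAbs s ((1 + x) * y) ^ 3) - 2 * (x * W) ^ 3 / s ^ 2 := by
  set p := softAbs s ((1 + x) * y) with hp
  set p₀ := softAbs s y with hp₀
  have hps : s ≤ p := le_softAbs _ _
  have hpp : 0 < p := hs.trans_le hps
  have hp2 : p ^ 2 = ((1 + x) * y) ^ 2 + s ^ 2 := softAbs_sq _ _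
  have hp02 : p₀ ^ 2 = y ^ 2 + s ^ 2 := softAbs_sq _ _
  have hp0 : 0 ≤ p₀ := softAbs_nonneg _ _
  have herr : 2 * (x * W) ^ 3 / s ^ 2 ≤ x * s / 24 := by
    rw [div_le_iff₀ (by positivity)]
    nlinarith [mul_le_mul_of_nonneg_left hxs hx.le]
  have hgain : 0 ≤ s ^ 2 * x ^ 2 / (2 * W * p ^ 3) := by positivity
  suffices (1 + x / 3) * p₀ ≤ p + s ^ 2 * x ^ 2 / (2 * W * p ^ 3) by linarith
  rcases le_total (s ^ 2) (y ^ 2) with h | h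
  · have : (1 + x / 3) * p₀ ≤ p := by
      refine le_of_sq_le_sq ?_ hpp.le
      rw [mul_pow, hp2, hp02]
      nlinarith [mul_le_mul_of_nonneg_left h hx.le, mul_nonneg (sq_nonneg x) (sq_nonneg y),
        mul_nonneg hx.le (sq_nonneg s),
        mul_nonneg (mul_nonneg hx.le (sub_nonneg.mpr hx1)) (sq_nonneg s)]
    linarith
  · have hp0p : p₀ ≤ p := by
      refine le_of_sq_le_sq ?_ hpp.le
      rw [hp2, hp02]
      nlinarith [mul_nonneg hx.le (sq_nonneg y), mul_nonneg (sq_nonneg x) (sq_nonneg y)]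
    have hp0s : p₀ ≤ 3 / 2 * s := le_of_sq_le_sq (by nlinarith) (by positivity)
    have hx4 : (1 + x) ^ 2 ≤ 4 := by nlinarith
    have hp5 : p ^ 2 ≤ 5 * s ^ 2 := by
      rw [hp2, mul_pow]
      nlinarith [mul_le_mul_of_nonneg_right hx4 (sq_nonneg y)]
    have hp94 : p ≤ 9 / 4 * s := le_of_sq_le_sq (by nlinarith) (by positivity)
    have hp3 : p ^ 3 ≤ 12 * s ^ 3 := by
      calc p ^ 3 = p ^ 2 * p := by ring
        _ ≤ 5 * s ^ 2 * (9 / 4 * s) := by gcongr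
        _ ≤ 12 * s ^ 3 := by nlinarith [pow_pos hs 3]
    have : x * s / 2 ≤ s ^ 2 * x ^ 2 / (2 * W * p ^ 3) := by
      rw [le_div_iff₀ (by positivity)]
      rw [le_div_iff₀ (by positivity)] at hsx
      calc x * s / 2 * (2 * W * p ^ 3) = x * s * W * p ^ 3 := by ring
        _ ≤ x * s * W * (12 * s ^ 3) := by gcongr
        _ = x * s ^ 2 * (s ^ 2 * (12 * W)) := by ring
        _ ≤ x * s ^ 2 * x := by gcongr
        _ = _ := by ring
    nlinarith

end SoftAbs

/-! ### Escape from a strict saddle point -/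

section Saddle

variable {d : ℕ} {f : EuclideanSpace ℝ (Fin d) → ℝ} {Ξ : Type*} [MeasurableSpace Ξ]
  {μ : Measure Ξ} {ξ : EuclideanSpace ℝ (Fin d) → Ξ → EuclideanSpace ℝ (Fin d)} {W η : ℝ}

/-- Noisy gradient descent with all the constants of the problem controlled by one number `W`:
`f` is twice differentiable with `W`-Lipschitz gradient and Hessian, and the noise is of size `W`
with variance at least `1 / W` in every direction. The step size is small against `W`. -/
structure IsNoisyDescent (f : EuclideanSpace ℝ (Fin d) → ℝ) (μ : Measure Ξ)
    (ξ : EuclideanSpace ℝ (Fin d) → Ξ → EuclideanSpace ℝ (Fin d)) (W η : ℝ) : Prop where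
  differentiable : Differentiable ℝ f
  differentiable_gradient : Differentiable ℝ (gradient f)
  smooth : IsSmooth f W
  hessian_lipschitz : HasLipschitzHessian f W
  noise : IsNoise μ ξ W
  two_le : 2 ≤ W
  step_pos : 0 < η
  step_small : η * W ^ 100 ≤ 1

/-- The step size absorbs any power of `W` up to `100`. -/
theorem IsNoisyDescent.mul_pow_le (h : IsNoisyDescent f μ ξ W η) {k : ℕ} (hk : k ≤ 100) :
    η * W ^ k ≤ 1 :=
  (mul_le_mul_of_nonneg_left (pow_le_pow_right₀ (by linarith [h.two_le]) hk)
    h.step_pos.le).trans h.step_small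

variable [IsProbabilityMeasure μ]

/-- The expectation of `φ` after `n` steps from `w`. -/
local notation "𝔼[" n "]" => (transition μ (noisyStep η (gradient f) ξ))^[n]

theorem IsNoisyDescent.locBddStep (h : IsNoisyDescent f μ ξ W η) :
    LocBddStep μ (noisyStep η (gradient f) ξ) :=
  h.noise.locBddStep h.differentiable_gradient.continuous η

/-- One step of the localization estimate. The parameter `T` splits the cross term; over `T` steps
the factor `1 + 1/T` accumulates to at most `e`. -/
theorem transition_dist_sq_le (h : IsNoisyDescent f μ ξ W η) {T : ℝ} (hT : 0 < T)
    (w₀ w : EuclideanSpace ℝ (Fin d)) :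
    transition μ (noisyStep η (gradient f) ξ) (fun w => ‖w - w₀‖ ^ 2) w
      ≤ (1 + 1 / T) * ‖w - w₀‖ ^ 2 + ((1 + T) * η ^ 2) * ‖gradient f w‖ ^ 2 + η ^ 2 * W ^ 2 := by
  have h1 := h.noise.integral_norm_sub_sq_le w (w - w₀ - η • gradient f w) η
  have h2 : ∀ x, noisyStep η (gradient f) ξ w x - w₀
      = (w - w₀ - η • gradient f w) - η • ξ w x := fun x => by rw [noisyStep]; module
  have h3 : ‖w - w₀ - η • gradient f w‖ ^ 2
      ≤ (1 + 1 / T) * ‖w - w₀‖ ^ 2 + ((1 + T) * η ^ 2) * ‖gradient f w‖ ^ 2 := by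
    have h4 : ‖w - w₀ - η • gradient f w‖ ≤ ‖w - w₀‖ + η * ‖gradient f w‖ := by
      refine (norm_sub_le _ _).trans_eq ?_
      rw [norm_smul, Real.norm_of_nonneg h.step_pos.le]
    refine (pow_le_pow_left₀ (norm_nonneg _) h4 2).trans ?_
    have h5 : 0 ≤ (‖w - w₀‖ - T * (η * ‖gradient f w‖)) ^ 2 / T := by positivity
    have h6 : (‖w - w₀‖ - T * (η * ‖gradient f w‖)) ^ 2 / T = 1 / T * ‖w - w₀‖ ^ 2
        - 2 * ‖w - w₀‖ * (η * ‖gradient f w‖) + T * (η * ‖gradient f w‖) ^ 2 := by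
      field_simp
      ring
    nlinarith
  simp only [transition, h2]
  linarith

/-- If the accumulated squared gradients stay at the noise level for `T ≲ 1 / η` steps, the chain
stays at distance `O(√η)` from its starting point. -/
theorem iterate_dist_sq_le (h : IsNoisyDescent f μ ξ W η) {T : ℕ} (hT : 0 < T)
    (w₀ : EuclideanSpace ℝ (Fin d)) (hTη : η * T ≤ W ^ 12)
    (hsum : ∑ k ∈ Finset.range T, 𝔼[k] (fun w => ‖gradient f w‖ ^ 2) w₀ ≤ W ^ 5 * η * T)
    {t : ℕ} (ht : t ≤ T) : 𝔼[t] (fun w => ‖w - w₀‖ ^ 2) w₀ ≤ η * W ^ 33 := by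
  have hW := h.two_le
  have hη := h.step_pos
  have hT1 : (1 : ℝ) ≤ T := by exact_mod_cast hT
  have hT0 : (0 : ℝ) < T := by linarith
  have hgB : LocBdd (fun w => ‖gradient f w‖ ^ 2) :=
    LocBdd.of_continuous (h.differentiable_gradient.continuous.norm.pow 2)
  have hdB : LocBdd (fun w => ‖w - w₀‖ ^ 2) :=
    LocBdd.of_continuous ((continuous_id.sub continuous_const).norm.pow 2)
  have hg0 : ∀ k, 0 ≤ 𝔼[k] (fun w => ‖gradient f w‖ ^ 2) w₀ := fun k => by
    have := iterate_mono h.locBddStep (LocBdd.of_continuous continuous_const) hgB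
      (fun w => sq_nonneg ‖gradient f w‖) k w₀
    rwa [iterate_const] at this
  have key : ∀ t : ℕ, 𝔼[t] (fun w => ‖w - w₀‖ ^ 2) w₀ ≤ (1 + 1 / (T : ℝ)) ^ t *
      ((1 + T) * η ^ 2 * ∑ k ∈ Finset.range t, 𝔼[k] (fun w => ‖gradient f w‖ ^ 2) w₀
        + t * (η ^ 2 * W ^ 2)) := by
    intro t
    induction t with
    | zero => simp
    | succ t ih =>
      have h1 := iterate_succ_le h.locBddStep hdB hdB hgB
        (fun w => transition_dist_sq_le h hT0 w₀ w) t w₀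
      refine h1.trans ?_
      have hq : 1 ≤ (1 + 1 / (T : ℝ)) ^ (t + 1) := one_le_pow₀ (by
        have : 0 ≤ 1 / (T : ℝ) := by positivity
        linarith)
      have hb : 0 ≤ (1 + T) * η ^ 2 * 𝔼[t] (fun w => ‖gradient f w‖ ^ 2) w₀ + η ^ 2 * W ^ 2 := by
        have := hg0 t
        positivity
      have h2 := mul_le_mul_of_nonneg_left ih (show 0 ≤ 1 + 1 / (T : ℝ) by positivity)
      have h3 := mul_le_mul_of_nonneg_right hq hb
      rw [Finset.sum_range_succ]
      push_cast
      rw [pow_succ' (1 + 1 / (T : ℝ)) t] at h3 ⊢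
      linarith
  refine (key t).trans ?_
  have hexp : (1 + 1 / (T : ℝ)) ^ t ≤ 3 := by
    calc (1 + 1 / (T : ℝ)) ^ t ≤ (1 + 1 / (T : ℝ)) ^ T :=
          pow_le_pow_right₀ (by
            have : 0 ≤ 1 / (T : ℝ) := by positivity
            linarith) ht
      _ ≤ Real.exp (1 / T) ^ T := by
          gcongr
          linarith [Real.add_one_le_exp (1 / (T : ℝ))]
      _ = Real.exp 1 := by
          rw [← Real.exp_nat_mul]
          congr 1
          field_simp
      _ ≤ 3 := by linarith [Real.exp_one_lt_d9]
  have hsum' : ∑ k ∈ Finset.range t, 𝔼[k] (fun w => ‖gradient f w‖ ^ 2) w₀ ≤ W ^ 5 * η * T :=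
    (Finset.sum_le_sum_of_subset_of_nonneg (Finset.range_mono ht) fun k _ _ => hg0 k).trans hsum
  have hsum0 : 0 ≤ ∑ k ∈ Finset.range t, 𝔼[k] (fun w => ‖gradient f w‖ ^ 2) w₀ :=
    Finset.sum_nonneg fun k _ => hg0 k
  have htT : (t : ℝ) ≤ T := by exact_mod_cast ht
  calc _ ≤ 3 * ((T + T) * η ^ 2 * (W ^ 5 * η * T) + T * (η ^ 2 * W ^ 2)) := by gcongr
    _ = 3 * η * (2 * W ^ 5 * (η * T) ^ 2 + W ^ 2 * (η * T)) := by ring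
    _ ≤ 3 * η * (2 * W ^ 5 * (W ^ 12) ^ 2 + W ^ 2 * W ^ 12) := by gcongr
    _ = η * (6 * W ^ 29 + 3 * W ^ 14) := by ring
    _ ≤ η * (W ^ 4 * W ^ 29) := by
        have h1 : W ^ 14 ≤ W ^ 29 := pow_le_pow_right₀ (by linarith) (by norm_num)
        have h2 : (2 : ℝ) ^ 4 ≤ W ^ 4 := by gcongr
        have h3 := mul_le_mul_of_nonneg_right h2 (show 0 ≤ W ^ 29 by positivity)
        have h4 : 0 ≤ W ^ 29 := by positivity
        gcongr
        linarith
    _ = η * W ^ 33 := by ring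

/-- The component along a unit vector `v` of the gradient of the quadratic model of `f` at `w₀`,
when `v` is an eigenvector of the Hessian at `w₀` for the eigenvalue `-γ₀`. -/
noncomputable def modelSlope (f : EuclideanSpace ℝ (Fin d) → ℝ) (w₀ v : EuclideanSpace ℝ (Fin d))
    (γ₀ : ℝ) (w : EuclideanSpace ℝ (Fin d)) : ℝ :=
  inner ℝ v (gradient f w₀) - γ₀ * inner ℝ v (w - w₀)

theorem continuous_modelSlope (w₀ v : EuclideanSpace ℝ (Fin d)) (γ₀ : ℝ) :
    Continuous (modelSlope f w₀ v γ₀) := by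
  unfold modelSlope
  fun_prop

theorem abs_inner_gradient_sub_modelSlope_le (h : IsNoisyDescent f μ ξ W η)
    {w₀ v : EuclideanSpace ℝ (Fin d)} {γ₀ : ℝ} (hv : ‖v‖ = 1) (hHv : hessian f w₀ v = -(γ₀ • v))
    (w : EuclideanSpace ℝ (Fin d)) :
    |inner ℝ v (gradient f w) - modelSlope f w₀ v γ₀ w| ≤ W * ‖w - w₀‖ ^ 2 := by
  have h1 := norm_gradient_sub_sub_hessian_le h.differentiable_gradient
    (by linarith [h.two_le]) h.hessian_lipschitz w₀ (w - w₀)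
  rw [add_sub_cancel] at h1
  have h2 : inner ℝ v (gradient f w) - modelSlope f w₀ v γ₀ w
      = inner ℝ v (gradient f w - gradient f w₀ - hessian f w₀ (w - w₀)) := by
    rw [inner_sub_right, inner_sub_right,
      ← hessian_symm h.differentiable h.differentiable_gradient, hHv, inner_neg_left,
      inner_smul_left, modelSlope]
    simp
    ring
  rw [h2]
  refine (abs_real_inner_le_norm _ _).trans ?_
  rwa [hv, one_mul]

/-- Along a direction of negative curvature the slope of the quadratic model grows geometrically,
up to the error of the model. -/
theorem le_transition_softAbs_modelSlope (h : IsNoisyDescent f μ ξ W η)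
    {w₀ v : EuclideanSpace ℝ (Fin d)} {γ₀ : ℝ} (hv : ‖v‖ = 1) (hHv : hessian f w₀ v = -(γ₀ • v))
    (hγ₀ : 0 < γ₀) {s : ℝ} (hs : 0 < s) (hx1 : η * γ₀ ≤ 1) (hsx : s ^ 2 ≤ η * γ₀ / (12 * W))
    (hxW : η * γ₀ * W ≤ s) (hxs : 48 * ((η * γ₀) ^ 2 * W ^ 3) ≤ s ^ 3)
    (w : EuclideanSpace ℝ (Fin d)) :
    (1 + η * γ₀ / 3) * softAbs s (modelSlope f w₀ v γ₀ w) - η * γ₀ * s / 24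
        - η * γ₀ * (W * ‖w - w₀‖ ^ 2)
      ≤ transition μ (noisyStep η (gradient f) ξ)
          (fun w => softAbs s (modelSlope f w₀ v γ₀ w)) w := by
  have hη := h.step_pos
  have hW := h.two_le
  set x := η * γ₀ with hx
  have hx0 : 0 < x := by positivity
  set y := modelSlope f w₀ v γ₀ w with hy
  set e := inner ℝ v (gradient f w) - y with he
  have hle : |e| ≤ W * ‖w - w₀‖ ^ 2 := abs_inner_gradient_sub_modelSlope_le h hv hHv w
  have hstep : ∀ a, modelSlope f w₀ v γ₀ (noisyStep η (gradient f) ξ w a)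
      = (1 + x) * y + x * inner ℝ v (ξ w a) + x * e := fun a => by
    rw [he, hx, hy, modelSlope, modelSlope, noisyStep, sub_right_comm, inner_sub_right _ (w - w₀),
      inner_smul_right, inner_add_right]
    ring
  have h1 := le_integral_softAbs (h.noise.measurable_inner w v)
    (by simpa [hv] using h.noise.abs_inner_le w v) (h.noise.integral_inner_eq_zero w v)
    (h.noise.variance w v hv) hs hx0.le hxW ((1 + x) * y)
  have h2 := softAbs_growth hs hx0 hx1 (by linarith) hsx hxs y
  have i1 : Integrable (fun a => softAbs s (modelSlope f w₀ v γ₀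
      (noisyStep η (gradient f) ξ w a))) μ :=
    (LocBdd.of_continuous (φ := fun w => softAbs s (modelSlope f w₀ v γ₀ w))
      ((continuous_softAbs s).comp (continuous_modelSlope w₀ v γ₀))).integrable h.locBddStep w
  have h3 : ∫ a, softAbs s ((1 + x) * y + x * inner ℝ v (ξ w a)) ∂μ
      ≤ ∫ a, (softAbs s (modelSlope f w₀ v γ₀ (noisyStep η (gradient f) ξ w a)) + x * |e|) ∂μ := by
    refine integral_mono_of_nonneg (.of_forall fun _ => softAbs_nonneg _ _)
      (i1.add (integrable_const _)) (.of_forall fun a => ?_)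
    have := softAbs_le_add s ((1 + x) * y + x * inner ℝ v (ξ w a))
      ((1 + x) * y + x * inner ℝ v (ξ w a) + x * e)
    rw [sub_add_cancel_left, abs_neg, abs_mul, abs_of_pos hx0] at this
    beta_reduce
    rwa [hstep]
  rw [integral_add i1 (integrable_const _)] at h3
  simp only [integral_const, probReal_univ, one_smul] at h3
  have h4 := mul_le_mul_of_nonneg_left hle hx0.le
  simp only [transition]
  linarith

/-- From a point with a direction of curvature at most `-1/W`, either the gradients become large or
the chain is localized, and then the quadratic model forces them to become large. -/
theorem le_sum_iterate_norm_gradient_sq (h : IsNoisyDescent f μ ξ W η)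
    {w₀ : EuclideanSpace ℝ (Fin d)} (hneg : LambdaMinLE (hessian f w₀) (-(1 / W))) {T₁ : ℕ}
    (hT₁ : W ^ 10 ≤ η * T₁) (hT₁' : η * (2 * T₁ : ℕ) ≤ W ^ 12) :
    W ^ 5 * η * (2 * T₁ : ℕ) ≤
      ∑ k ∈ Finset.range (2 * T₁), 𝔼[k] (fun w => ‖gradient f w‖ ^ 2) w₀ := by
  by_contra! hcon
  have hη := h.step_pos
  have hW := h.two_le
  have hW0 : 0 < W := by linarith
  obtain ⟨γ₀, v, hγ, hv, hHv⟩ := hneg.exists_unit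
  have hγ0 : 0 < γ₀ := lt_of_lt_of_le (by positivity) hγ
  have hγW : γ₀ ≤ W := by
    have := norm_hessian_apply_le hW0.le h.smooth w₀ v
    rwa [hHv, norm_neg, norm_smul, hv, mul_one, mul_one, Real.norm_of_nonneg hγ0.le] at this
  have hT0 : 0 < T₁ := by
    rcases Nat.eq_zero_or_pos T₁ with h0 | h0
    · rw [h0] at hT₁
      have : 0 < W ^ 10 := by positivity
      simp at hT₁
      linarith
    · exact h0
  set s := √(η / (12 * W ^ 2)) with hs_def
  have hs2 : s ^ 2 = η / (12 * W ^ 2) := Real.sq_sqrt (by positivity)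
  have hs : 0 < s := Real.sqrt_pos.mpr (by positivity)
  set x := η * γ₀ with hx
  have hx0 : 0 < x := by positivity
  have hxW : x ≤ η * W := by rw [hx]; gcongr
  have hxl : η / W ≤ x := by
    rw [hx, div_eq_mul_one_div]
    gcongr
  have p2 : ∀ k : ℕ, (2 : ℝ) ^ k ≤ W ^ k := fun k => by gcongr
  have hx1 : x ≤ 1 := hxW.trans (by simpa using h.mul_pow_le (k := 1) (by norm_num))
  have hsx : s ^ 2 ≤ x / (12 * W) := by
    rw [hs2, show η / (12 * W ^ 2) = η / W / (12 * W) by field_simp]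
    gcongr
  -- Both smallness conditions on `s ∼ √η` are checked after squaring.
  have hxs1 : x * W ≤ s := by
    refine le_of_sq_le_sq ?_ hs.le
    calc (x * W) ^ 2 ≤ (η * W * W) ^ 2 := by gcongr
      _ = η * W ^ 4 * η := by ring
      _ ≤ 1 / (12 * W ^ 2) * η := by
          gcongr
          rw [le_div_iff₀ (by positivity)]
          have := mul_le_mul_of_nonneg_left (p2 4) (show 0 ≤ η * W ^ 6 by positivity)
          have := h.mul_pow_le (k := 10) (by norm_num)
          nlinarith
      _ = s ^ 2 := by rw [hs2]; ring
  have hxs : 48 * (x ^ 2 * W ^ 3) ≤ s ^ 3 := by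
    refine le_of_sq_le_sq ?_ (by positivity)
    calc (48 * (x ^ 2 * W ^ 3)) ^ 2 ≤ (48 * ((η * W) ^ 2 * W ^ 3)) ^ 2 := by gcongr
      _ = 2304 * 1728 * (η * W ^ 16) * (η ^ 3 / (1728 * W ^ 6)) := by field_simp; norm_num
      _ ≤ 1 * (η ^ 3 / (1728 * W ^ 6)) := by
          gcongr
          have h1 := mul_le_mul_of_nonneg_left (p2 23) (show 0 ≤ η * W ^ 16 by positivity)
          have := h.mul_pow_le (k := 39) (by norm_num)
          nlinarith
      _ = (s ^ 2) ^ 3 := by rw [hs2]; field_simp; norm_num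
      _ = (s ^ 3) ^ 2 := by ring
  have hloc : ∀ t ≤ 2 * T₁, W * 𝔼[t] (fun w => ‖w - w₀‖ ^ 2) w₀ ≤ s / 24 := fun t ht => by
    refine (mul_le_mul_of_nonneg_left (iterate_dist_sq_le h (by omega) w₀ hT₁' hcon.le ht)
      hW0.le).trans ?_
    refine le_of_sq_le_sq ?_ (by positivity)
    rw [div_pow, hs2]
    calc (W * (η * W ^ 33)) ^ 2 = η * W ^ 68 * η := by ring
      _ ≤ 1 / (12 * W ^ 2 * 24 ^ 2) * η := by
          gcongr
          rw [le_div_iff₀ (by positivity)]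
          have h1 := mul_le_mul_of_nonneg_left (p2 13) (show 0 ≤ η * W ^ 70 by positivity)
          have := h.mul_pow_le (k := 83) (by norm_num)
          nlinarith
      _ = _ := by ring
  have hΦ : LocBdd (fun w => softAbs s (modelSlope f w₀ v γ₀ w)) :=
    LocBdd.of_continuous ((continuous_softAbs s).comp (continuous_modelSlope w₀ v γ₀))
  have hdB : LocBdd (fun w => ‖w - w₀‖ ^ 2) :=
    LocBdd.of_continuous ((continuous_id.sub continuous_const).norm.pow 2)
  have hgB : LocBdd (fun w => ‖gradient f w‖) :=
    LocBdd.of_continuous h.differentiable_gradient.continuous.norm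
  have hgB2 : LocBdd (fun w => ‖gradient f w‖ ^ 2) :=
    LocBdd.of_continuous (h.differentiable_gradient.continuous.norm.pow 2)
  set p : ℕ → ℝ := fun t => 𝔼[t] (fun w => softAbs s (modelSlope f w₀ v γ₀ w)) w₀ with hp
  have hps : ∀ t, s ≤ p t := fun t => by
    have := iterate_mono h.locBddStep (LocBdd.of_continuous continuous_const) hΦ
      (fun w => le_softAbs s (modelSlope f w₀ v γ₀ w)) t w₀
    rwa [iterate_const] at this
  have hgrow : ∀ t < 2 * T₁, (1 + x / 4) * p t ≤ p (t + 1) := fun t ht => by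
    have h1 := iterate_mono h.locBddStep (hΦ.affine hdB (1 + x / 3) (-(x * W)) (-(x * s / 24)))
      (hΦ.of_transition h.locBddStep) (fun w => by
        have := le_transition_softAbs_modelSlope h hv hHv hγ0 hs hx1 hsx hxs1 hxs w
        linarith) t w₀
    rw [iterate_affine h.locBddStep hΦ hdB, ← Function.iterate_succ_apply] at h1
    have h2 := mul_le_mul_of_nonneg_left (hloc t ht.le) hx0.le
    have h3 := mul_le_mul_of_nonneg_left (hps t) hx0.le
    simp only [hp] at h3 ⊢
    linarith
  have hpow : ∀ t ≤ 2 * T₁, (1 + x / 4) ^ t * s ≤ p t := fun t => by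
    induction t with
    | zero => intro _; simpa using hps 0
    | succ t ih =>
      intro ht
      have := mul_le_mul_of_nonneg_left (ih (by omega)) (show 0 ≤ 1 + x / 4 by positivity)
      have := hgrow t (by omega)
      rw [pow_succ']
      linarith
  set c := s * W ^ 9 / 8 with hc
  have hlarge : ∀ t, T₁ ≤ t → t < 2 * T₁ → c ≤ 𝔼[t] (fun w => ‖gradient f w‖) w₀ := by
    intro t h1 h2
    have hTx : W ^ 9 ≤ T₁ * x := by
      calc W ^ 9 = W ^ 10 / W := by field_simp
        _ ≤ η * T₁ / W := by gcongr
        _ = T₁ * (η / W) := by ring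
        _ ≤ T₁ * x := by gcongr
    -- Bernoulli's inequality is enough: only a factor polynomial in `W` has to be gained.
    have h3 : 1 + W ^ 9 / 4 ≤ (1 + x / 4) ^ t := by
      refine le_trans ?_ (one_add_mul_le_pow (show -2 ≤ x / 4 by linarith) t)
      have : (T₁ : ℝ) * x ≤ t * x := by gcongr
      linarith
    have h4 := (mul_le_mul_of_nonneg_right h3 hs.le).trans (hpow t h2.le)
    have h5 := iterate_mono h.locBddStep (hΦ.affine hdB 1 (-W) (-s)) hgB (fun w => by
      have a1 := abs_inner_gradient_sub_modelSlope_le h hv hHv w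
      have a2 := abs_real_inner_le_norm v (gradient f w)
      have a3 := softAbs_le hs.le (modelSlope f w₀ v γ₀ w)
      have a4 := abs_sub_abs_le_abs_sub (modelSlope f w₀ v γ₀ w) (inner ℝ v (gradient f w))
      rw [abs_sub_comm] at a4
      rw [hv, one_mul] at a2
      linarith) t w₀
    rw [iterate_affine h.locBddStep hΦ hdB] at h5
    have h6 := hloc t h2.le
    have h7 := mul_le_mul_of_nonneg_left (p2 9) hs.le
    simp only [hp] at h4
    rw [hc]
    linarith
  have hc0 : 0 ≤ c := by positivity
  have hsq : ∀ t, T₁ ≤ t → t < 2 * T₁ → c ^ 2 ≤ 𝔼[t] (fun w => ‖gradient f w‖ ^ 2) w₀ := by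
    intro t h1 h2
    -- Jensen's inequality, from `2 c a - c² ≤ a²`.
    have h3 := iterate_mono h.locBddStep (hgB.affine hgB (2 * c) 0 (-c ^ 2)) hgB2 (fun w => by
      nlinarith [sq_nonneg (‖gradient f w‖ - c)]) t w₀
    rw [iterate_affine h.locBddStep hgB hgB] at h3
    have h4 := mul_le_mul_of_nonneg_left (hlarge t h1 h2) hc0
    linarith
  have hg0 : ∀ k, 0 ≤ 𝔼[k] (fun w => ‖gradient f w‖ ^ 2) w₀ := fun k => by
    have := iterate_mono h.locBddStep (LocBdd.of_continuous continuous_const) hgB2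
      (fun w => sq_nonneg ‖gradient f w‖) k w₀
    rwa [iterate_const] at this
  set g : ℕ → ℝ := fun k => 𝔼[k] (fun w => ‖gradient f w‖ ^ 2) w₀
  have hfin : T₁ * c ^ 2 ≤ ∑ k ∈ Finset.range (2 * T₁), g k := by
    calc (T₁ : ℝ) * c ^ 2 = ∑ k ∈ Finset.Ico T₁ (2 * T₁), c ^ 2 := by
          rw [Finset.sum_const, Nat.card_Ico, nsmul_eq_mul]
          congr 2
          omega
      _ ≤ ∑ k ∈ Finset.Ico T₁ (2 * T₁), g k :=
          Finset.sum_le_sum fun k hk => by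
            rw [Finset.mem_Ico] at hk
            exact hsq k hk.1 hk.2
      _ ≤ ∑ k ∈ Finset.range (2 * T₁), g k :=
          Finset.sum_le_sum_of_subset_of_nonneg
          (fun k hk => by
            rw [Finset.mem_Ico] at hk
            exact Finset.mem_range.mpr hk.2) fun k _ _ => hg0 k
  have hc2 : W ^ 5 * η * 2 ≤ c ^ 2 := by
    rw [hc, div_pow, mul_pow, hs2, div_mul_eq_mul_div, div_div, le_div_iff₀ (by positivity)]
    have h1 := mul_le_mul_of_nonneg_left (p2 11) (show 0 ≤ W ^ 7 * η by positivity)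
    nlinarith
  have hcon' : ∑ k ∈ Finset.range (2 * T₁), g k < W ^ 5 * η * (2 * T₁ : ℕ) := hcon
  push_cast at hcon'
  have := mul_le_mul_of_nonneg_left hc2 (Nat.cast_nonneg (α := ℝ) T₁)
  linarith

/-- Near a saddle point the objective decreases by `η²` per step on average over `2 T₁` steps. -/
theorem iterate_objective_le_of_saddle (h : IsNoisyDescent f μ ξ W η)
    {w₀ : EuclideanSpace ℝ (Fin d)} (hneg : LambdaMinLE (hessian f w₀) (-(1 / W))) {T₁ : ℕ}
    (hT₁ : W ^ 10 ≤ η * T₁) (hT₁' : η * (2 * T₁ : ℕ) ≤ W ^ 12) :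
    𝔼[2 * T₁] f w₀ ≤ f w₀ - η ^ 2 * (2 * T₁ : ℕ) := by
  have hW := h.two_le
  refine iterate_objective_le_of_large_sum h.noise h.differentiable h.differentiable_gradient
    (by linarith) h.smooth h.step_pos.le ?_ (D := W ^ 5) ?_
    (le_sum_iterate_norm_gradient_sq h hneg hT₁ hT₁')
  · have h1 := h.mul_pow_le (k := 2) (by norm_num)
    have h2 := mul_le_mul_of_nonneg_left hW (mul_nonneg h.step_pos.le (by linarith : 0 ≤ W))
    nlinarith
  · have h1 : (2 : ℝ) ^ 2 ≤ W ^ 2 := by gcongr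
    have h2 : (2 : ℝ) ^ 3 ≤ W ^ 3 := by gcongr
    have h3 := mul_le_mul_of_nonneg_left h1 (show 0 ≤ W ^ 3 by positivity)
    nlinarith

end Saddle

/-! ### Stability of strongly convex minima -/

section Stability

variable {d : ℕ} {f : EuclideanSpace ℝ (Fin d) → ℝ} {Ξ : Type*} [MeasurableSpace Ξ]
  {μ : Measure Ξ} {ξ : EuclideanSpace ℝ (Fin d) → Ξ → EuclideanSpace ℝ (Fin d)} {W η : ℝ}

/-- The expectation of `φ` after `n` steps from `w`. -/
local notation "𝔼[" n "]" => (transition μ (noisyStep η (gradient f) ξ))^[n]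

/-- The exponential Lyapunov function around a minimum. The exponent is normalized so that the
quadratic term produced by Hoeffding's lemma is half of the contraction due to strong convexity. -/
noncomputable def lyapunov (W η : ℝ) (wstar w : EuclideanSpace ℝ (Fin d)) : ℝ :=
  Real.exp (1 / (4 * η * W ^ 3) * ‖w - wstar‖ ^ 2)

theorem continuous_lyapunov (W η : ℝ) (wstar : EuclideanSpace ℝ (Fin d)) :
    Continuous (lyapunov W η wstar) := by
  unfold lyapunov
  fun_prop

/-- A gradient step contracts the distance to a strongly convex minimum. -/
theorem norm_sub_gradient_step_sq_le (h : IsNoisyDescent f μ ξ W η)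
    {wstar w : EuclideanSpace ℝ (Fin d)} {R : ℝ} (hmin : IsLocalMin f wstar)
    (hconv : StronglyConvexOn f (1 / W) (Metric.closedBall wstar R)) (hw : ‖w - wstar‖ ≤ R) :
    ‖w - wstar - η • gradient f w‖ ^ 2 ≤ (1 - η / W) * ‖w - wstar‖ ^ 2 := by
  have hη := h.step_pos
  have hW0 : 0 < W := by linarith [h.two_le]
  have h1 := hconv.le_inner_gradient h.differentiable h.differentiable_gradient hmin hw
  have h2 : ‖gradient f w‖ ≤ W * ‖w - wstar‖ := by
    simpa [gradient_eq_zero_of_isLocalMin hmin] using h.smooth w wstar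
  have h3 : ‖gradient f w‖ ^ 2 ≤ W ^ 2 * ‖w - wstar‖ ^ 2 := by
    rw [← mul_pow]
    gcongr
  rw [norm_sub_sq_real, inner_smul_right, norm_smul, mul_pow, Real.norm_of_nonneg hη.le,
    real_inner_comm]
  have h4 : η ^ 2 * W ^ 2 ≤ η / W := by
    rw [le_div_iff₀ hW0]
    have := mul_le_mul_of_nonneg_left (h.mul_pow_le (k := 3) (by norm_num)) hη.le
    linarith
  have h5 := mul_le_mul_of_nonneg_left h3 (sq_nonneg η)
  have h6 := mul_le_mul_of_nonneg_right h4 (sq_nonneg ‖w - wstar‖)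
  have h7 := mul_le_mul_of_nonneg_left h1 hη.le
  have e : η * (1 / W * ‖w - wstar‖ ^ 2) = η / W * ‖w - wstar‖ ^ 2 := by ring
  linarith

variable [IsProbabilityMeasure μ]

/-- Hoeffding's lemma for a component of the noise. -/
theorem IsNoise.integral_exp_le (h : IsNoise μ ξ W) (w a : EuclideanSpace ℝ (Fin d)) (t : ℝ) :
    Integrable (fun x => Real.exp (t * inner ℝ a (ξ w x))) μ ∧
    ∫ x, Real.exp (t * inner ℝ a (ξ w x)) ∂μ ≤ Real.exp ((‖a‖ * W) ^ 2 * t ^ 2 / 2) := by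
  have hsub := hasSubgaussianMGF_of_mem_Icc_of_integral_eq_zero (μ := μ)
    (X := fun x => inner ℝ a (ξ w x)) (a := -(‖a‖ * W)) (b := ‖a‖ * W)
    (h.measurable_inner w a).aemeasurable
    (by filter_upwards [h.abs_inner_le w a] with x hx using abs_le.mp hx)
    (h.integral_inner_eq_zero w a)
  refine ⟨hsub.integrable_exp_mul t, ?_⟩
  have h1 := hsub.mgf_le t
  have h2 : (((‖‖a‖ * W - -(‖a‖ * W)‖₊ / 2) ^ 2 : NNReal) : ℝ) = (‖a‖ * W) ^ 2 := by
    push_cast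
    rw [Real.norm_eq_abs, sub_neg_eq_add, ← two_mul, abs_mul, abs_two,
      mul_div_cancel_left₀ _ two_ne_zero, sq_abs]
  rwa [h2] at h1

/-- The elementary inequality behind the drift bound: a contraction in the exponent beats the
additive noise term as soon as the exponent is at least `1 / 2`. -/
theorem exp_contraction_le {c X : ℝ} (hc : 0 ≤ c) (hc1 : c ≤ 1) (hX : 0 ≤ X) :
    Real.exp (X * (1 - c) + c / 2) ≤ Real.exp X + 3 := by
  rcases le_total (1 / 2) X with h | h
  · have : Real.exp (X * (1 - c) + c / 2) ≤ Real.exp X := Real.exp_le_exp.mpr (by nlinarith)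
    linarith
  · have : Real.exp (X * (1 - c) + c / 2) ≤ Real.exp 1 := Real.exp_le_exp.mpr (by nlinarith)
    linarith [Real.exp_one_lt_d9, Real.exp_pos X]

/-- The drift of the Lyapunov function near a strongly convex minimum. -/
theorem transition_lyapunov_le (h : IsNoisyDescent f μ ξ W η)
    {wstar w : EuclideanSpace ℝ (Fin d)} {R : ℝ} (hmin : IsLocalMin f wstar)
    (hconv : StronglyConvexOn f (1 / W) (Metric.closedBall wstar R)) (hw : ‖w - wstar‖ ≤ R) :
    transition μ (noisyStep η (gradient f) ξ) (lyapunov W η wstar) w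
      ≤ lyapunov W η wstar w + 3 := by
  have hη := h.step_pos
  have hW0 : 0 < W := by linarith [h.two_le]
  set a := w - wstar - η • gradient f w with ha
  have ha2 := norm_sub_gradient_step_sq_le h hmin hconv hw
  rw [← ha] at ha2
  set θ := 1 / (4 * η * W ^ 3) with hθ
  have hθ0 : 0 < θ := by positivity
  obtain ⟨hint, hexp⟩ := h.noise.integral_exp_le w a (-(2 * θ * η))
  have hpt : ∀ᵐ x ∂μ, lyapunov W η wstar (noisyStep η (gradient f) ξ w x)
      ≤ Real.exp (θ * (‖a‖ ^ 2 + η ^ 2 * W ^ 2))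
        * Real.exp (-(2 * θ * η) * inner ℝ a (ξ w x)) := by
    filter_upwards [h.noise.bound w] with x hx
    have e : noisyStep η (gradient f) ξ w x - wstar = a - η • ξ w x := by
      rw [noisyStep, ha]; module
    rw [lyapunov, e, ← Real.exp_add, norm_sub_sq_real, inner_smul_right, norm_smul, mul_pow,
      Real.norm_of_nonneg hη.le]
    refine Real.exp_le_exp.mpr ?_
    have : ‖ξ w x‖ ^ 2 ≤ W ^ 2 := by gcongr
    have := mul_le_mul_of_nonneg_left (mul_le_mul_of_nonneg_left this (sq_nonneg η)) hθ0.le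
    linarith
  have h1 := integral_mono_ae
    ((LocBdd.of_continuous (continuous_lyapunov W η wstar)).integrable h.locBddStep w)
    (hint.const_mul _) hpt
  rw [integral_const_mul] at h1
  refine h1.trans ((mul_le_mul_of_nonneg_left hexp (Real.exp_pos _).le).trans ?_)
  rw [← Real.exp_add]
  have hc1 : η / (2 * W) ≤ 1 := by
    rw [div_le_one (by positivity)]
    have := h.mul_pow_le (k := 0) (by norm_num)
    linarith [h.two_le]
  refine le_trans (Real.exp_le_exp.mpr ?_) (exp_contraction_le (by positivity) hc1
    (X := θ * ‖w - wstar‖ ^ 2) (by positivity))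
  have hz : ‖a‖ ^ 2 ≤ ‖w - wstar‖ ^ 2 := ha2.trans (by
    have : 0 ≤ η / W * ‖w - wstar‖ ^ 2 := by positivity
    linarith)
  have e1 : (‖a‖ * W) ^ 2 * (-(2 * θ * η)) ^ 2 / 2 = θ * (η / (2 * W)) * ‖a‖ ^ 2 := by
    rw [hθ]; field_simp; norm_num
  have e2 : θ * (η ^ 2 * W ^ 2) = η / (2 * W) / 2 := by
    rw [hθ]; field_simp; norm_num
  have e3 : η / W = 2 * (η / (2 * W)) := by field_simp
  rw [mul_add, e1, e2]
  rw [e3] at ha2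
  have h2 := mul_le_mul_of_nonneg_left ha2 hθ0.le
  have h3 := mul_le_mul_of_nonneg_left hz (show 0 ≤ θ * (η / (2 * W)) by positivity)
  linarith

/-- The probability of being further than `r` from a strongly convex minimum after `n` steps.
The bound holds for every starting point: outside the ball of radius `r` it is trivial. -/
theorem iterate_exit_le (h : IsNoisyDescent f μ ξ W η)
    {wstar : EuclideanSpace ℝ (Fin d)} {R r : ℝ} (hmin : IsLocalMin f wstar)
    (hconv : StronglyConvexOn f (1 / W) (Metric.closedBall wstar R)) (hr0 : 0 ≤ r) (hr : r ≤ R)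
    {χ : EuclideanSpace ℝ (Fin d) → ℝ} (hχ : LocBdd χ) (hχ1 : ∀ w, χ w ≤ 1)
    (hχ0 : ∀ w, ‖w - wstar‖ < r → χ w = 0) (n : ℕ) (w : EuclideanSpace ℝ (Fin d)) :
    𝔼[n] χ w * Real.exp (1 / (4 * η * W ^ 3) * r ^ 2) ≤ lyapunov W η wstar w + 3 * n := by
  have hη := h.step_pos
  have hW0 : 0 < W := by linarith [h.two_le]
  set Λ := Real.exp (1 / (4 * η * W ^ 3) * r ^ 2) with hΛ
  have hΛ0 : 0 < Λ := Real.exp_pos _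
  have hV := LocBdd.of_continuous (continuous_lyapunov W η wstar)
  induction n generalizing w with
  | zero =>
    by_cases hw : ‖w - wstar‖ < r
    · simp [hχ0 w hw, lyapunov, Real.exp_nonneg]
    · have : Λ ≤ lyapunov W η wstar w := Real.exp_le_exp.mpr (by gcongr; exact not_lt.mp hw)
      have := mul_le_mul_of_nonneg_right (hχ1 w) hΛ0.le
      simp only [Function.iterate_zero, id_eq, Nat.cast_zero]
      linarith
  | succ n ih =>
    by_cases hw : ‖w - wstar‖ < r
    · rw [Function.iterate_succ_apply']
      have h1 := transition_mono h.locBddStep (hχ.iterate h.locBddStep n)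
        (hV.affine hV (1 / Λ) 0 (3 * n / Λ)) (fun w => by
          have : 1 / Λ * lyapunov W η wstar w + 0 * lyapunov W η wstar w + 3 * n / Λ
              = (lyapunov W η wstar w + 3 * n) / Λ := by ring
          rw [this, le_div_iff₀ hΛ0]
          exact ih w) w
      rw [transition_affine h.locBddStep hV hV] at h1
      have h2 := transition_lyapunov_le h hmin hconv (hw.le.trans hr)
      have h3 := mul_le_mul_of_nonneg_right h1 hΛ0.le
      have e : (1 / Λ * transition μ (noisyStep η (gradient f) ξ) (lyapunov W η wstar) w
          + 0 * transition μ (noisyStep η (gradient f) ξ) (lyapunov W η wstar) w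
          + 3 * n / Λ) * Λ
          = transition μ (noisyStep η (gradient f) ξ) (lyapunov W η wstar) w + 3 * n := by
        field_simp
        ring
      rw [e] at h3
      push_cast
      linarith
    · have h1 : Λ ≤ lyapunov W η wstar w := Real.exp_le_exp.mpr (by gcongr; exact not_lt.mp hw)
      have h2 : 𝔼[n + 1] χ w ≤ 1 := by
        have := iterate_mono h.locBddStep hχ (LocBdd.of_continuous continuous_const) hχ1 (n + 1) w
        rwa [iterate_const] at this
      have := mul_le_mul_of_nonneg_right h2 hΛ0.le
      push_cast
      have : (0 : ℝ) ≤ n := n.cast_nonneg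
      linarith

end Stability

/-! ### Reaching a neighbourhood of the minima -/

section Hitting

variable {E Ξ : Type*} [NormedAddCommGroup E] [MeasurableSpace E] [MeasurableSpace Ξ]
  {μ : Measure Ξ} [IsProbabilityMeasure μ] {F : E → Ξ → E}

/-- For `χ` the indicator of a set, the probability of being in this set at the times
`0, …, n`. -/
noncomputable def survival (μ : Measure Ξ) (F : E → Ξ → E) (χ : E → ℝ) : ℕ → E → ℝ
  | 0 => χ
  | n + 1 => fun w => χ w * transition μ F (survival μ F χ n) w

/-- For `χ` the indicator of a set, the expected number of steps before time `n` which the chain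
makes before it leaves this set. -/
noncomputable def occupation (μ : Measure Ξ) (F : E → Ξ → E) (χ : E → ℝ) : ℕ → E → ℝ
  | 0 => fun _ => 0
  | n + 1 => fun w => χ w * (1 + transition μ F (occupation μ F χ n) w)

/-- `χ` is the indicator function of a measurable set. -/
structure IsIndicator (χ : E → ℝ) : Prop where
  measurable : Measurable χ
  zero_or_one : ∀ w, χ w = 0 ∨ χ w = 1

variable {χ : E → ℝ}

theorem IsIndicator.nonneg (hχ : IsIndicator χ) (w : E) : 0 ≤ χ w := by
  rcases hχ.zero_or_one w with h | h <;> simp [h]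

theorem IsIndicator.le_one (hχ : IsIndicator χ) (w : E) : χ w ≤ 1 := by
  rcases hχ.zero_or_one w with h | h <;> simp [h]

theorem IsIndicator.locBdd (hχ : IsIndicator χ) : LocBdd χ :=
  LocBdd.of_bounded hχ.measurable (C := 1) fun w => abs_le.mpr
    ⟨by linarith [hχ.nonneg w], hχ.le_one w⟩

theorem transition_mem_Icc {φ : E → ℝ} (hF : LocBddStep μ F) (hφ : LocBdd φ) {a b : ℝ}
    (h : ∀ w, φ w ∈ Set.Icc a b) (w : E) : transition μ F φ w ∈ Set.Icc a b := by
  have hc : ∀ c : ℝ, LocBdd (fun _ : E => c) := fun c =>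
    LocBdd.of_bounded measurable_const (C := |c|) fun _ => le_rfl
  have h1 := transition_mono hF (hc a) hφ (fun w => (h w).1) w
  have h2 := transition_mono hF hφ (hc b) (fun w => (h w).2) w
  simp only [transition, integral_const, probReal_univ, one_smul] at h1 h2
  exact ⟨h1, h2⟩

theorem survival_locBdd_and_mem_Icc (hF : LocBddStep μ F) (hχ : IsIndicator χ) (n : ℕ) :
    LocBdd (survival μ F χ n) ∧ ∀ w, survival μ F χ n w ∈ Set.Icc 0 1 := by
  induction n with
  | zero => exact ⟨hχ.locBdd, fun w => ⟨hχ.nonneg w, hχ.le_one w⟩⟩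
  | succ n ih =>
    have hm := transition_mem_Icc hF ih.1 ih.2
    have hI : ∀ w, survival μ F χ (n + 1) w ∈ Set.Icc 0 1 := fun w =>
      ⟨mul_nonneg (hχ.nonneg w) (hm w).1, mul_le_one₀ (hχ.le_one w) (hm w).1 (hm w).2⟩
    refine ⟨LocBdd.of_bounded (hχ.measurable.mul (ih.1.of_transition hF).measurable) (C := 1)
      fun w => abs_le.mpr ⟨by linarith [(hI w).1], (hI w).2⟩, hI⟩

theorem occupation_locBdd_and_mem_Icc (hF : LocBddStep μ F) (hχ : IsIndicator χ) (n : ℕ) :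
    LocBdd (occupation μ F χ n) ∧ ∀ w, occupation μ F χ n w ∈ Set.Icc 0 (n : ℝ) := by
  induction n with
  | zero => exact ⟨LocBdd.of_bounded measurable_const (C := 0) fun w => by simp [occupation],
      fun w => by simp [occupation]⟩
  | succ n ih =>
    have hm := transition_mem_Icc hF ih.1 ih.2
    have hI : ∀ w, occupation μ F χ (n + 1) w ∈ Set.Icc 0 ((n + 1 : ℕ) : ℝ) := fun w => by
      obtain ⟨h1, h2⟩ := hm w
      have h3 := hχ.nonneg w
      have h4 := mul_le_mul_of_nonneg_right (hχ.le_one w)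
        (show 0 ≤ 1 + transition μ F (occupation μ F χ n) w by linarith)
      refine ⟨mul_nonneg h3 (by linarith), ?_⟩
      simp only [occupation]
      push_cast
      linarith
    refine ⟨LocBdd.of_bounded (hχ.measurable.mul
      ((ih.1.of_transition hF).measurable.const_add 1)) (C := (n + 1 : ℕ))
      fun w => abs_le.mpr ⟨by linarith [(hI w).1, (hI w).2], (hI w).2⟩, hI⟩

/-- Markov's inequality for the exit time. -/
theorem mul_survival_le_occupation (hF : LocBddStep μ F) (hχ : IsIndicator χ) (n : ℕ) (w : E) :
    n * survival μ F χ n w ≤ occupation μ F χ n w := by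
  induction n generalizing w with
  | zero => simp [occupation]
  | succ n ih =>
    have hS := survival_locBdd_and_mem_Icc hF hχ n
    have h1 := transition_mono hF (hS.1.affine hS.1 n 0 0)
      (occupation_locBdd_and_mem_Icc hF hχ n).1 (fun w => by simpa using ih w) w
    rw [transition_affine hF hS.1 hS.1] at h1
    have h2 := (transition_mem_Icc hF hS.1 hS.2 w).2
    simp only [survival, occupation]
    push_cast
    have := mul_le_mul_of_nonneg_left (show (n + 1) * transition μ F (survival μ F χ n) w
      ≤ 1 + transition μ F (occupation μ F χ n) w by linarith) (hχ.nonneg w)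
    linarith

theorem occupation_add_le (hF : LocBddStep μ F) (hχ : IsIndicator χ) (m n : ℕ) (w : E) :
    occupation μ F χ (m + n) w ≤ m + (transition μ F)^[m] (occupation μ F χ n) w := by
  induction m generalizing w with
  | zero => simp
  | succ m ih =>
    have hn := (occupation_locBdd_and_mem_Icc hF hχ n).1.iterate hF m
    have hmn := occupation_locBdd_and_mem_Icc hF hχ (m + n)
    rw [Nat.add_right_comm m 1 n, Function.iterate_succ_apply']
    have h1 := transition_mono hF hmn.1 (hn.affine hn 1 0 m) (fun w => by linarith [ih w]) w
    rw [transition_affine hF hn hn] at h1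
    have h2 := (transition_mem_Icc hF hmn.1 hmn.2 w).1
    have h3 := mul_le_mul_of_nonneg_right (hχ.le_one w)
      (show 0 ≤ 1 + transition μ F (occupation μ F χ (m + n)) w by linarith)
    simp only [occupation]
    push_cast
    linarith

/-- If from every point of the set a bounded number `m ≤ T` of steps decreases `f` by at least
`c m` in expectation, then the expected time spent in the set is at most of order `1 / c`. -/
theorem mul_occupation_le (hF : LocBddStep μ F) (hχ : IsIndicator χ) {f : E → ℝ} (hf : LocBdd f)
    {B c : ℝ} (hB : ∀ w, -B ≤ f w) (hc : 0 ≤ c) {T : ℕ}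
    (hdec : ∀ w, χ w = 0 ∨ ∃ m : ℕ, 0 < m ∧ m ≤ T ∧ (transition μ F)^[m] f w ≤ f w - c * m)
    (n : ℕ) (w : E) : c * occupation μ F χ n w ≤ f w + B + c * T := by
  induction n using Nat.strong_induction_on generalizing w with
  | _ n ih =>
    have hcT : 0 ≤ c * T := by positivity
    rcases hdec w with h0 | ⟨m, hm0, hmT, hm⟩
    · have : occupation μ F χ n w = 0 := by
        cases n <;> simp [occupation, h0]
      rw [this]
      linarith [hB w]
    · rcases lt_or_ge n m with hnm | hnm
      · have h1 := ((occupation_locBdd_and_mem_Icc hF hχ n).2 w).2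
        have h2 : (n : ℝ) ≤ T := by exact_mod_cast hnm.le.trans hmT
        have := mul_le_mul_of_nonneg_left (h1.trans h2) hc
        linarith [hB w]
      · obtain ⟨k, rfl⟩ := Nat.exists_eq_add_of_le hnm
        have h1 := occupation_add_le hF hχ m k w
        have hk := (occupation_locBdd_and_mem_Icc hF hχ k).1
        have h2 := iterate_mono hF (hk.affine hk c 0 0) (hf.affine hf 1 0 (B + c * T))
          (fun w => by linarith [ih k (by omega) w]) m w
        rw [iterate_affine hF hk hk, iterate_affine hF hf hf] at h2
        have := mul_le_mul_of_nonneg_left h1 hc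
        linarith

/-- The Markov property: survival for `N` more steps costs a factor `c` whenever it does so from
every starting point. -/
theorem survival_add_le (hF : LocBddStep μ F) (hχ : IsIndicator χ) {N : ℕ} {c : ℝ}
    (hN : ∀ w, survival μ F χ N w ≤ c * χ w) (n : ℕ) (w : E) :
    survival μ F χ (n + N) w ≤ c * survival μ F χ n w := by
  induction n generalizing w with
  | zero => simpa [survival] using hN w
  | succ n ih =>
    have hn := (survival_locBdd_and_mem_Icc hF hχ n).1
    rw [Nat.add_right_comm n 1 N]
    have h1 := transition_mono hF (survival_locBdd_and_mem_Icc hF hχ (n + N)).1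
      (hn.affine hn c 0 0) (fun w => by linarith [ih w]) w
    rw [transition_affine hF hn hn] at h1
    have := mul_le_mul_of_nonneg_left h1 (hχ.nonneg w)
    simp only [survival]
    linarith

theorem survival_le_indicator (hF : LocBddStep μ F) (hχ : IsIndicator χ) (n : ℕ) (w : E) :
    survival μ F χ n w ≤ χ w := by
  cases n with
  | zero => exact le_rfl
  | succ n =>
    have hS := survival_locBdd_and_mem_Icc hF hχ n
    exact mul_le_of_le_one_right (hχ.nonneg w) (transition_mem_Icc hF hS.1 hS.2 w).2

theorem survival_le_half_pow (hF : LocBddStep μ F) (hχ : IsIndicator χ) {N : ℕ}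
    (hN : ∀ w, survival μ F χ N w ≤ 1 / 2) {m n : ℕ} (hn : m * N ≤ n) (w : E) :
    survival μ F χ n w ≤ (1 / 2) ^ m := by
  have hN' : ∀ w, survival μ F χ N w ≤ 1 / 2 * χ w := fun w => by
    rcases hχ.zero_or_one w with h | h
    · simpa [h] using survival_le_indicator hF hχ N w
    · simpa [h] using hN w
  have hpow : ∀ m : ℕ, survival μ F χ (m * N) w ≤ (1 / 2) ^ m := by
    intro m
    induction m with
    | zero => simpa [survival] using hχ.le_one w
    | succ m ih =>
      rw [Nat.succ_mul, pow_succ']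
      exact (survival_add_le hF hχ hN' _ w).trans (by linarith)
  obtain ⟨k, rfl⟩ := Nat.exists_eq_add_of_le hn
  refine le_trans ?_ (hpow m)
  simpa using survival_add_le hF hχ (c := 1) (N := k)
    (fun w => by simpa using survival_le_indicator hF hχ k w) (m * N) w

/-- A bad event at time `n` has small probability if it has small probability once the chain has
left the set, and the chain leaves the set with high probability. -/
theorem iterate_le_survival_add (hF : LocBddStep μ F) (hχ : IsIndicator χ) {ψ : E → ℝ}
    (hψ : LocBdd ψ) (hψ1 : ∀ w, ψ w ≤ 1) {κ : ℝ} (hκ : 0 ≤ κ) {T : ℕ}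
    (h : ∀ w, χ w = 0 → ∀ n ≤ T, (transition μ F)^[n] ψ w ≤ κ) {n : ℕ} (hn : n ≤ T) (w : E) :
    (transition μ F)^[n] ψ w ≤ survival μ F χ n w + κ := by
  induction n generalizing w with
  | zero =>
    rcases hχ.zero_or_one w with h0 | h1
    · simpa [survival, h0] using h w h0 0 hn
    · simp only [survival, h1, Function.iterate_zero, id_eq]
      linarith [hψ1 w]
  | succ n ih =>
    have hS := (survival_locBdd_and_mem_Icc hF hχ n).1
    rcases hχ.zero_or_one w with h0 | h1
    · simpa [survival, h0] using h w h0 (n + 1) hn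
    · rw [Function.iterate_succ_apply']
      have := transition_mono hF (hψ.iterate hF n) (hS.affine hS 1 0 κ)
        (fun w => by linarith [ih (by omega) w]) w
      rw [transition_affine hF hS hS] at this
      simp only [survival, h1]
      linarith

end Hitting

/-! ### The failure probability of noisy gradient descent -/

section Failure

variable {d : ℕ} {f : EuclideanSpace ℝ (Fin d) → ℝ} {Ξ : Type*} [MeasurableSpace Ξ]
  {μ : Measure Ξ} [IsProbabilityMeasure μ]
  {ξ : EuclideanSpace ℝ (Fin d) → Ξ → EuclideanSpace ℝ (Fin d)} {W η : ℝ}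

/-- The expectation of `φ` after `n` steps from `w`. -/
local notation "𝔼[" n "]" => (transition μ (noisyStep η (gradient f) ξ))^[n]

/-- The target of the first phase: the points within `√(W⁷ η)` of a strongly convex minimum. -/
def nearMin (f : EuclideanSpace ℝ (Fin d) → ℝ) (W η δ : ℝ) : Set (EuclideanSpace ℝ (Fin d)) :=
  {w | ∃ wstar, IsLocalMin f wstar ∧
    StronglyConvexOn f (1 / W) (Metric.closedBall wstar (2 * δ)) ∧ ‖w - wstar‖ < √(W ^ 7 * η)}

theorem measurableSet_nearMin (f : EuclideanSpace ℝ (Fin d) → ℝ) (W η δ : ℝ) :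
    MeasurableSet (nearMin f W η δ) := by
  refine IsOpen.measurableSet ?_
  have : nearMin f W η δ = ⋃ wstar ∈ {wstar | IsLocalMin f wstar ∧
      StronglyConvexOn f (1 / W) (Metric.closedBall wstar (2 * δ))},
      Metric.ball wstar (√(W ^ 7 * η)) := by
    ext w
    simp [nearMin, dist_eq_norm, and_assoc]
  rw [this]
  exact isOpen_biUnion fun _ _ => Metric.isOpen_ball

/-- Away from `nearMin` the objective decreases in expectation by at least `η²` per step, over one
step or over the time needed to escape a saddle point. -/
theorem mem_nearMin_or_decrease (h : IsNoisyDescent f μ ξ W η) {δ : ℝ} (hδ : 0 ≤ δ)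
    (hcover : ∀ w, 1 / W ≤ ‖gradient f w‖ ∨ LambdaMinLE (hessian f w) (-(1 / W)) ∨
      ∃ wstar, IsLocalMin f wstar ∧ ‖w - wstar‖ ≤ δ ∧
        StronglyConvexOn f (1 / W) (Metric.closedBall wstar (2 * δ)))
    (w : EuclideanSpace ℝ (Fin d)) :
    w ∈ nearMin f W η δ ∨ ∃ m : ℕ, 0 < m ∧ m ≤ 2 * ⌈W ^ 10 / η⌉₊ ∧
      𝔼[m] f w ≤ f w - η ^ 2 * m := by
  have hη := h.step_pos
  have hW := h.two_le
  have hW0 : 0 < W := by linarith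
  have hceil : 0 < ⌈W ^ 10 / η⌉₊ := Nat.ceil_pos.mpr (by positivity)
  have hη1 := h.mul_pow_le (k := 0) (by norm_num)
  rcases le_or_gt (W ^ 5 * η) (‖gradient f w‖ ^ 2) with hg | hg
  · refine Or.inr ⟨1, one_pos, by omega, ?_⟩
    have h1 : η * W ≤ 1 / 2 := by
      have h2 := h.mul_pow_le (k := 2) (by norm_num)
      have := mul_le_mul_of_nonneg_left hW (show 0 ≤ η * W by positivity)
      nlinarith
    have h2 : 2 * W * W ^ 2 + 2 ≤ W ^ 5 := by
      have h2 : (2 : ℝ) ^ 2 ≤ W ^ 2 := by gcongr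
      have h3 : (2 : ℝ) ^ 3 ≤ W ^ 3 := by gcongr
      have := mul_le_mul_of_nonneg_left h2 (show 0 ≤ W ^ 3 by positivity)
      nlinarith
    simpa using transition_objective_le_of_large_gradient h.noise h.differentiable
      h.differentiable_gradient hW0.le h.smooth hη.le h1 h2 hg
  · rcases hcover w with h1 | h1 | ⟨wstar, hmin, hd, hconv⟩
    · exfalso
      have h2 : (1 / W) ^ 2 ≤ ‖gradient f w‖ ^ 2 := by gcongr
      have h3 : W ^ 5 * η ≤ (1 / W) ^ 2 := by
        rw [div_pow, one_pow, le_div_iff₀ (by positivity)]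
        have := h.mul_pow_le (k := 7) (by norm_num)
        linarith
      linarith
    · right
      refine ⟨2 * ⌈W ^ 10 / η⌉₊, by omega, le_rfl, iterate_objective_le_of_saddle h h1 ?_ ?_⟩
      · rw [mul_comm, ← div_le_iff₀ hη]
        exact Nat.le_ceil _
      · have h2 := (Nat.ceil_lt_add_one (show 0 ≤ W ^ 10 / η by positivity)).le
        have h3 := mul_le_mul_of_nonneg_left h2 hη.le
        rw [mul_add, mul_div_cancel₀ _ hη.ne'] at h3
        push_cast
        have h4 : (2 : ℝ) ^ 2 ≤ W ^ 2 := by gcongr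
        have h5 : 1 ≤ W ^ 10 := one_le_pow₀ (by linarith)
        have := mul_le_mul_of_nonneg_left h4 (show 0 ≤ W ^ 10 by positivity)
        nlinarith
    · refine Or.inl ⟨wstar, hmin, hconv, Real.lt_sqrt_of_sq_lt ?_⟩
      have h1 := hconv.le_inner_gradient h.differentiable h.differentiable_gradient hmin
        (hd.trans (by linarith))
      have h2 := h1.trans (real_inner_le_norm _ _)
      have h3 : ‖w - wstar‖ ≤ W * ‖gradient f w‖ := by
        rcases (norm_nonneg (w - wstar)).eq_or_lt with h0 | h0
        · rw [← h0]; positivity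
        · rw [pow_two, ← mul_assoc] at h2
          have := le_of_mul_le_mul_right h2 h0
          rw [one_div, inv_mul_le_iff₀ hW0] at this
          exact this
      calc ‖w - wstar‖ ^ 2 ≤ (W * ‖gradient f w‖) ^ 2 := by gcongr
        _ = W ^ 2 * ‖gradient f w‖ ^ 2 := by ring
        _ < W ^ 2 * (W ^ 5 * η) := by gcongr
        _ = W ^ 7 * η := by ring

/-- From every starting point, `nearMin` is reached within `W⁴ / η²` steps with probability at least
`1 / 2`. -/
theorem survival_le_half (h : IsNoisyDescent f μ ξ W η) {δ : ℝ} (hδ : 0 ≤ δ)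
    (hf : ∀ w, |f w| ≤ W)
    (hcover : ∀ w, 1 / W ≤ ‖gradient f w‖ ∨ LambdaMinLE (hessian f w) (-(1 / W)) ∨
      ∃ wstar, IsLocalMin f wstar ∧ ‖w - wstar‖ ≤ δ ∧
        StronglyConvexOn f (1 / W) (Metric.closedBall wstar (2 * δ)))
    {χ : EuclideanSpace ℝ (Fin d) → ℝ} (hχ : IsIndicator χ) (hχ0 : ∀ w ∈ nearMin f W η δ, χ w = 0)
    (w : EuclideanSpace ℝ (Fin d)) :
    survival μ (noisyStep η (gradient f) ξ) χ ⌈W ^ 4 / η ^ 2⌉₊ w ≤ 1 / 2 := by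
  have hη := h.step_pos
  have hW := h.two_le
  have hW0 : 0 < W := by linarith
  set N := ⌈W ^ 4 / η ^ 2⌉₊ with hN
  set T := 2 * ⌈W ^ 10 / η⌉₊ with hT
  have h1 := mul_occupation_le h.locBddStep hχ (LocBdd.of_continuous h.differentiable.continuous)
    (B := W) (c := η ^ 2) (T := T) (fun w => (abs_le.mp (hf w)).1) (by positivity) (fun w => by
      rcases mem_nearMin_or_decrease h hδ hcover w with hw | hw
      · exact Or.inl (hχ0 w hw)
      · exact Or.inr hw) N w
  have h2 := mul_survival_le_occupation h.locBddStep hχ N w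
  have h3 : W ^ 4 ≤ η ^ 2 * N := by
    rw [mul_comm, ← div_le_iff₀ (by positivity)]
    exact Nat.le_ceil _
  have h4 : η ^ 2 * T ≤ 1 := by
    have h5 := (Nat.ceil_lt_add_one (show 0 ≤ W ^ 10 / η by positivity)).le
    have h6 := mul_le_mul_of_nonneg_left h5 hη.le
    rw [mul_add, mul_div_cancel₀ _ hη.ne'] at h6
    have h7 : η * T ≤ 4 * W ^ 10 := by
      rw [hT]
      push_cast
      have h8 := h.mul_pow_le (k := 0) (by norm_num)
      have h9 : 1 ≤ W ^ 10 := one_le_pow₀ (by linarith)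
      nlinarith
    have h8 : (2 : ℝ) ^ 2 ≤ W ^ 2 := by gcongr
    have h9 := mul_le_mul_of_nonneg_left h7 hη.le
    have h10 := mul_le_mul_of_nonneg_left h8 (show 0 ≤ η * W ^ 10 by positivity)
    have h11 := h.mul_pow_le (k := 12) (by norm_num)
    nlinarith
  have h5 := (survival_locBdd_and_mem_Icc h.locBddStep hχ N).2 w
  have h6 := mul_le_mul_of_nonneg_left h2 (sq_nonneg η)
  have h7 := mul_le_mul_of_nonneg_right h3 h5.1
  have h8 := (abs_le.mp (hf w)).2
  have h9 : 4 * W + 2 ≤ W ^ 4 := by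
    have : (2 : ℝ) ^ 3 ≤ W ^ 3 := by gcongr
    have := mul_le_mul_of_nonneg_left this hW0.le
    nlinarith
  have h10 := mul_le_mul_of_nonneg_right h9 h5.1
  have h11 : (4 * W + 2) * survival μ (noisyStep η (gradient f) ξ) χ N w
      ≤ (4 * W + 2) * (1 / 2) := by
    linarith
  exact le_of_mul_le_mul_left h11 (by positivity)

theorem mul_log_inv_le {x : ℝ} (hx : 0 < x) : x * Real.log (1 / x) ≤ 2 * √x := by
  have hs : 0 < √x := Real.sqrt_pos.mpr hx
  have h1 : 1 / x = (1 / √x) ^ 2 := by rw [div_pow, Real.sq_sqrt hx.le, one_pow]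
  have h2 := Real.log_le_self (show 0 ≤ 1 / √x by positivity)
  rw [h1, Real.log_pow]
  calc x * ((2 : ℕ) * Real.log (1 / √x)) ≤ x * ((2 : ℕ) * (1 / √x)) := by gcongr
    _ = 2 * (√x ^ 2 * (1 / √x)) := by rw [Real.sq_sqrt hx.le]; push_cast; ring
    _ = 2 * √x := by field_simp

/-- The confidence radius is smaller than the radius of strong convexity. -/
theorem radius_le {ζ : ℝ} (hW : 2 ≤ W) (hη : 0 < η) (hζ : 0 < ζ)
    (hsmall : η * W ^ 100 * max 1 (Real.log (1 / ζ)) ≤ 1) :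
    W ^ 6 * √(η * Real.log (1 / (η * ζ))) ≤ 2 * (1 / W) := by
  have hW0 : 0 < W := by linarith
  have hl1 : 1 ≤ max 1 (Real.log (1 / ζ)) := le_max_left _ _
  have hη100 : η * W ^ 100 ≤ 1 := le_trans (le_mul_of_one_le_right (by positivity) hl1) hsmall
  have h1 : η * Real.log (1 / ζ) ≤ 1 / W ^ 50 := by
    rw [le_div_iff₀ (by positivity)]
    calc η * Real.log (1 / ζ) * W ^ 50 ≤ η * max 1 (Real.log (1 / ζ)) * W ^ 100 := by
          gcongr
          · exact le_max_right _ _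
          · linarith
          · norm_num
      _ ≤ 1 := by linarith
  have h2 : √η ≤ 1 / W ^ 50 := by
    refine Real.sqrt_le_iff.mpr ⟨by positivity, ?_⟩
    rw [div_pow, one_pow, ← pow_mul, le_div_iff₀ (by positivity)]
    exact hη100
  have h3 := mul_log_inv_le hη
  have h4 : η * Real.log (1 / (η * ζ)) ≤ 3 * (1 / W ^ 50) := by
    rw [show 1 / (η * ζ) = 1 / η * (1 / ζ) by field_simp,
      Real.log_mul (by positivity) (by positivity), mul_add]
    linarith
  refine (mul_le_mul_of_nonneg_left (Real.sqrt_le_sqrt h4) (by positivity)).trans ?_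
  refine le_of_sq_le_sq ?_ (by positivity)
  rw [mul_pow, Real.sq_sqrt (by positivity), mul_one_div, mul_one_div, div_pow,
    ← mul_div_assoc, div_le_div_iff₀ (by positivity) (by positivity)]
  have : W ^ 14 ≤ W ^ 50 := pow_le_pow_right₀ (by linarith) (by norm_num)
  have h5 : (0 : ℝ) ≤ W ^ 50 := by positivity
  calc (W ^ 6) ^ 2 * 3 * W ^ 2 = 3 * W ^ 14 := by ring
    _ ≤ 2 ^ 2 * W ^ 50 := by linarith

/-- Started in `nearMin`, the chain is at any given time up to the horizon outside the confidence
radius with probability at most `ζ / 2`. -/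
theorem iterate_exit_nearMin_le (h : IsNoisyDescent f μ ξ W η) {δ : ℝ} (hδ : 1 / W ≤ δ) {ζ : ℝ}
    (hζ : 0 < ζ) (hζ1 : ζ < 1) (hsmall : η * W ^ 100 * max 1 (Real.log (1 / ζ)) ≤ 1)
    {χ : EuclideanSpace ℝ (Fin d) → ℝ} (hχ : LocBdd χ) (hχ1 : ∀ w, χ w ≤ 1)
    (hχ0 : ∀ w wstar, IsLocalMin f wstar →
      ‖w - wstar‖ < W ^ 6 * √(η * Real.log (1 / (η * ζ))) → χ w = 0)
    {n : ℕ} (hn : n ≤ ⌈W ^ 8 * (η ^ 2)⁻¹ * max 1 (Real.log (1 / ζ))⌉₊)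
    {w : EuclideanSpace ℝ (Fin d)} (hw : w ∈ nearMin f W η δ) : 𝔼[n] χ w ≤ ζ / 2 := by
  obtain ⟨wstar, hmin, hconv, hw⟩ := hw
  have hη := h.step_pos
  have hW := h.two_le
  have hW0 : 0 < W := by linarith
  set L := Real.log (1 / (η * ζ)) with hL
  set l := max 1 (Real.log (1 / ζ)) with hl
  have hl1 : 1 ≤ l := le_max_left _ _
  have p2 : ∀ k : ℕ, (2 : ℝ) ^ k ≤ W ^ k := fun k => by gcongr
  have hη4 : 4 * η ≤ 1 := by
    have := mul_le_mul_of_nonneg_left (p2 2) hη.le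
    linarith [h.mul_pow_le (k := 2) (by norm_num)]
  have hη8 : 8 * η ≤ 1 := by
    have := mul_le_mul_of_nonneg_left (p2 3) hη.le
    linarith [h.mul_pow_le (k := 3) (by norm_num)]
  have hηζ : 0 < η * ζ := by positivity
  have hexpL : Real.exp L = 1 / (η * ζ) := Real.exp_log (by positivity)
  have hL1 : 1 ≤ L := by
    rw [hL, Real.le_log_iff_exp_le (by positivity), le_div_iff₀ hηζ]
    have h1 : η * ζ ≤ 1 / 4 * 1 := mul_le_mul (by linarith) hζ1.le hζ.le (by norm_num)
    nlinarith [Real.exp_one_lt_d9]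
  have hr := (radius_le hW hη hζ hsmall).trans
    (mul_le_mul_of_nonneg_left hδ (by norm_num : (0 : ℝ) ≤ 2))
  have key := iterate_exit_le h hmin hconv (r := W ^ 6 * √(η * L)) (by positivity) hr hχ hχ1
    (fun w hw => hχ0 w wstar hmin hw) n w
  have hθr : 1 / (4 * η * W ^ 3) * (W ^ 6 * √(η * L)) ^ 2 = W ^ 9 / 4 * L := by
    rw [mul_pow, Real.sq_sqrt (by positivity)]
    field_simp
  rw [hθr] at key
  have hV : lyapunov W η wstar w ≤ Real.exp (W ^ 4 / 4) := by
    refine Real.exp_le_exp.mpr ?_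
    have h1 : ‖w - wstar‖ ^ 2 ≤ W ^ 7 * η := by
      rw [← Real.sq_sqrt (show 0 ≤ W ^ 7 * η by positivity)]
      gcongr
    calc 1 / (4 * η * W ^ 3) * ‖w - wstar‖ ^ 2 ≤ 1 / (4 * η * W ^ 3) * (W ^ 7 * η) := by gcongr
      _ = W ^ 4 / 4 := by field_simp
  have hlζ : l ≤ 1 / ζ := by
    refine max_le ?_ (Real.log_le_self (by positivity))
    rw [le_div_iff₀ hζ]
    linarith
  have hnle : (n : ℝ) ≤ 1 / (η ^ 3 * ζ) := by
    have h1 : (n : ℝ) ≤ W ^ 8 * (η ^ 2)⁻¹ * l + 1 :=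
      (Nat.cast_le.mpr hn).trans (Nat.ceil_lt_add_one (by positivity)).le
    have h2 : 1 ≤ W ^ 8 * (η ^ 2)⁻¹ * l := by
      have h3 : 1 ≤ W ^ 8 := one_le_pow₀ (by linarith)
      have h4 : 1 ≤ (η ^ 2)⁻¹ := (one_le_inv₀ (by positivity)).mpr (by nlinarith)
      nlinarith [mul_le_mul h3 h4 zero_le_one (by positivity)]
    have h5 : 2 * W ^ 8 * η ≤ 1 := by
      have := mul_le_mul_of_nonneg_right hW (show 0 ≤ W ^ 8 * η by positivity)
      linarith [h.mul_pow_le (k := 9) (by norm_num)]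
    calc (n : ℝ) ≤ 2 * W ^ 8 * (η ^ 2)⁻¹ * l := by linarith
      _ = 2 * W ^ 8 * η * ((η ^ 3)⁻¹ * l) := by field_simp
      _ ≤ 1 * ((η ^ 3)⁻¹ * (1 / ζ)) := by gcongr
      _ = 1 / (η ^ 3 * ζ) := by field_simp
  have hΛ : Real.exp (W ^ 4 / 4) * (1 / (η * ζ)) ^ 4 ≤ Real.exp (W ^ 9 / 4 * L) := by
    rw [← hexpL, ← Real.exp_nat_mul, ← Real.exp_add]
    refine Real.exp_le_exp.mpr ?_
    push_cast
    have h1 := mul_le_mul_of_nonneg_left (p2 5) (show 0 ≤ W ^ 4 by positivity)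
    have h2 := p2 4
    have h3 : W ^ 4 / 4 + 4 ≤ W ^ 9 / 4 := by nlinarith
    have h4 : 0 ≤ W ^ 4 / 4 * (L - 1) := by
      have : 0 ≤ L - 1 := by linarith
      positivity
    nlinarith [mul_le_mul_of_nonneg_right h3 (show 0 ≤ L by linarith)]
  have hE : 1 ≤ Real.exp (W ^ 4 / 4) := Real.one_le_exp (by positivity)
  have hsum : lyapunov W η wstar w + 3 * n
      ≤ ζ / 2 * Real.exp (W ^ 9 / 4 * L) := by
    have h1 : 1 ≤ 1 / (η ^ 3 * ζ) := by
      rw [le_div_iff₀ (by positivity), one_mul]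
      have : η ^ 3 ≤ 1 := pow_le_one₀ hη.le (by linarith)
      exact mul_le_one₀ this hζ.le hζ1.le
    calc lyapunov W η wstar w + 3 * n
        ≤ Real.exp (W ^ 4 / 4) * (1 / (η ^ 3 * ζ))
          + 3 * (Real.exp (W ^ 4 / 4) * (1 / (η ^ 3 * ζ))) := by
          gcongr
          · exact hV.trans (le_mul_of_one_le_right (by positivity) h1)
          · exact hnle.trans (le_mul_of_one_le_left (by positivity) hE)
      _ = 8 * η * ζ ^ 2 * (ζ / 2 * (Real.exp (W ^ 4 / 4) * (1 / (η * ζ)) ^ 4)) := by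
          field_simp
          ring
      _ ≤ 1 * (ζ / 2 * Real.exp (W ^ 9 / 4 * L)) := by
          gcongr
          exact mul_le_one₀ hη8 (sq_nonneg ζ) (pow_le_one₀ hζ.le hζ1.le)
      _ = _ := one_mul _
  exact le_of_mul_le_mul_right (key.trans hsum) (Real.exp_pos _)

/-- After `⌈W⁸ η⁻² max(1, log(1/ζ))⌉` steps the chain is, with probability at least `1 - ζ`, within
the confidence radius of a local minimum. -/
theorem iterate_failure_le (h : IsNoisyDescent f μ ξ W η) {δ : ℝ} (hδ : 1 / W ≤ δ)
    (hf : ∀ w, |f w| ≤ W)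
    (hcover : ∀ w, 1 / W ≤ ‖gradient f w‖ ∨ LambdaMinLE (hessian f w) (-(1 / W)) ∨
      ∃ wstar, IsLocalMin f wstar ∧ ‖w - wstar‖ ≤ δ ∧
        StronglyConvexOn f (1 / W) (Metric.closedBall wstar (2 * δ)))
    {ζ : ℝ} (hζ : 0 < ζ) (hζ1 : ζ < 1) (hsmall : η * W ^ 100 * max 1 (Real.log (1 / ζ)) ≤ 1)
    {χ : EuclideanSpace ℝ (Fin d) → ℝ} (hχ : LocBdd χ) (hχ1 : ∀ w, χ w ≤ 1)
    (hχ0 : ∀ w wstar, IsLocalMin f wstar →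
      ‖w - wstar‖ < W ^ 6 * √(η * Real.log (1 / (η * ζ))) → χ w = 0)
    (w : EuclideanSpace ℝ (Fin d)) :
    𝔼[⌈W ^ 8 * (η ^ 2)⁻¹ * max 1 (Real.log (1 / ζ))⌉₊] χ w ≤ ζ := by
  have hη := h.step_pos
  have hW := h.two_le
  have hW0 : 0 < W := by linarith
  set l := max 1 (Real.log (1 / ζ)) with hl
  have hl1 : 1 ≤ l := le_max_left _ _
  set χG : EuclideanSpace ℝ (Fin d) → ℝ := (nearMin f W η δ)ᶜ.indicator 1 with hχG
  have hind : IsIndicator χG :=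
    ⟨measurable_one.indicator (measurableSet_nearMin f W η δ).compl, fun w => by
      by_cases hw : w ∈ nearMin f W η δ <;> simp [hχG, hw]⟩
  have hG0 : ∀ w ∈ nearMin f W η δ, χG w = 0 := fun w hw => by simp [hχG, hw]
  have hmem : ∀ w, χG w = 0 → w ∈ nearMin f W η δ := fun w hw => by
    by_contra hn
    simp [hχG, hn] at hw
  have h1 := iterate_le_survival_add h.locBddStep hind hχ hχ1 (κ := ζ / 2) (by positivity)
    (fun w hw n hn => iterate_exit_nearMin_le h hδ hζ hζ1 hsmall hχ hχ1 hχ0 hn (hmem w hw))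
    le_rfl w
  have hδ0 : 0 ≤ δ := le_trans (by positivity) hδ
  -- The number of independent attempts at reaching `nearMin`, each of `⌈W⁴ / η²⌉` steps.
  set m := ⌈4 * l⌉₊ with hm
  have hmN : m * ⌈W ^ 4 / η ^ 2⌉₊ ≤ ⌈W ^ 8 * (η ^ 2)⁻¹ * l⌉₊ := by
    have h2 : (m : ℝ) ≤ 4 * l + 1 := (Nat.ceil_lt_add_one (by positivity)).le
    have h3 := (Nat.ceil_lt_add_one (show 0 ≤ W ^ 4 / η ^ 2 by positivity)).le
    have hη1 : η ≤ 1 := by simpa using h.mul_pow_le (k := 0) (by norm_num)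
    have h4 : 1 ≤ W ^ 4 / η ^ 2 := by
      rw [le_div_iff₀ (by positivity), one_mul]
      exact (pow_le_one₀ hη.le hη1).trans (one_le_pow₀ (by linarith))
    have h5 : ((m * ⌈W ^ 4 / η ^ 2⌉₊ : ℕ) : ℝ) ≤ W ^ 8 * (η ^ 2)⁻¹ * l := by
      push_cast
      calc (m : ℝ) * ⌈W ^ 4 / η ^ 2⌉₊ ≤ (5 * l) * (2 * (W ^ 4 / η ^ 2)) := by
            gcongr
            · linarith
            · linarith
        _ = 10 * (W ^ 4 * (η ^ 2)⁻¹ * l) := by field_simp; norm_num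
        _ ≤ W ^ 4 * (W ^ 4 * (η ^ 2)⁻¹ * l) := by
            have : (2 : ℝ) ^ 4 ≤ W ^ 4 := by gcongr
            gcongr
            linarith
        _ = _ := by ring
    exact_mod_cast h5.trans (Nat.le_ceil _)
  have h2 := survival_le_half_pow h.locBddStep hind
    (survival_le_half h hδ0 hf hcover hind hG0) hmN w
  have h3 : (1 / 2 : ℝ) ^ m ≤ ζ / 2 := by
    have h4 : (1 / 2 : ℝ) ^ m = Real.exp (-(m * Real.log 2)) := by
      rw [Real.exp_neg, ← Real.log_pow, Real.exp_log (by positivity), one_div, inv_pow]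
    have h5 : 4 * l ≤ m := Nat.le_ceil _
    have h6 : l + l ≤ m * Real.log 2 := by
      nlinarith [Real.log_two_gt_d9]
    have h7 : Real.exp (-l) ≤ ζ := by
      have : Real.log (1 / ζ) ≤ l := le_max_right _ _
      rw [one_div, Real.log_inv] at this
      calc Real.exp (-l) ≤ Real.exp (Real.log ζ) := Real.exp_le_exp.mpr (by linarith)
        _ = ζ := Real.exp_log hζ
    have h8 : Real.exp (-l) ≤ 1 / 2 := by
      rw [Real.exp_neg, one_div]
      refine inv_anti₀ two_pos ?_
      linarith [Real.add_one_le_exp l]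
    rw [h4]
    calc Real.exp (-(m * Real.log 2)) ≤ Real.exp (-l + -l) := Real.exp_le_exp.mpr (by linarith)
      _ = Real.exp (-l) * Real.exp (-l) := Real.exp_add _ _
      _ ≤ ζ * (1 / 2) := by gcongr
      _ = ζ / 2 := by ring
  linarith

end Failure

/-! ### The uniform distribution on the sphere -/

section Sphere

open scoped Pointwise

variable {d : ℕ}

theorem uniformSphere_apply {s : Set (EuclideanSpace ℝ (Fin d))} (hs : MeasurableSet s) :
    uniformSphere d s = ((volume : Measure (EuclideanSpace ℝ (Fin d))).toSphere Set.univ)⁻¹ *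
      (d * volume (Set.Ioo (0 : ℝ) 1 • (s ∩ Metric.sphere 0 1))) := by
  rw [uniformSphere, Measure.map_apply measurable_subtype_coe hs, Measure.smul_apply, smul_eq_mul,
    Measure.toSphere_apply' _ (measurable_subtype_coe hs), Subtype.image_preimage_coe,
    finrank_euclideanSpace_fin, Set.inter_comm]

theorem isProbabilityMeasure_uniformSphere (hd : 0 < d) :
    IsProbabilityMeasure (uniformSphere d) := by
  have : Nontrivial (EuclideanSpace ℝ (Fin d)) := by
    have : Nonempty (Fin d) := ⟨⟨0, hd⟩⟩
    infer_instance
  refine ⟨?_⟩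
  rw [uniformSphere, Measure.map_apply measurable_subtype_coe MeasurableSet.univ, Set.preimage_univ,
    Measure.smul_apply, smul_eq_mul]
  refine ENNReal.inv_mul_cancel ?_ (measure_ne_top _ _)
  rw [Measure.measure_univ_ne_zero]
  exact Measure.toSphere_ne_zero _

theorem ae_norm_eq_one_uniformSphere : ∀ᵐ x ∂(uniformSphere d), ‖x‖ = 1 := by
  rw [uniformSphere, ae_map_iff measurable_subtype_coe.aemeasurable
    (measurableSet_eq_fun measurable_norm measurable_const)]
  exact .of_forall fun x => by simp

/-- The uniform distribution is invariant under isometries. -/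
theorem measurePreserving_uniformSphere
    (A : EuclideanSpace ℝ (Fin d) ≃ₗᵢ[ℝ] EuclideanSpace ℝ (Fin d)) :
    MeasurePreserving A (uniformSphere d) (uniformSphere d) := by
  have hA : Measurable A := A.continuous.measurable
  refine ⟨hA, Measure.ext fun s hs => ?_⟩
  rw [Measure.map_apply hA hs, uniformSphere_apply hs, uniformSphere_apply (hA hs)]
  congr 2
  have h1 : Set.Ioo (0 : ℝ) 1 • (A ⁻¹' s ∩ Metric.sphere 0 1)
      = A ⁻¹' (Set.Ioo (0 : ℝ) 1 • (s ∩ Metric.sphere 0 1)) := by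
    ext x
    simp only [Set.mem_smul, Set.mem_preimage, Set.mem_inter_iff, mem_sphere_zero_iff_norm]
    constructor
    · rintro ⟨c, hc, y, ⟨hy, hy1⟩, rfl⟩
      exact ⟨c, hc, A y, ⟨hy, by rwa [A.norm_map]⟩, by simp⟩
    · rintro ⟨c, hc, y, ⟨hy, hy1⟩, hxy⟩
      refine ⟨c, hc, A.symm y, ⟨by simpa using hy, by rwa [A.symm.norm_map]⟩, ?_⟩
      rw [← map_smul, hxy, A.symm_apply_apply]
  rw [h1]
  exact A.measurePreserving.measure_preimage_emb A.toHomeomorph.measurableEmbedding _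

theorem integrable_uniformSphere (hd : 0 < d) {F : Type*} [NormedAddCommGroup F]
    {φ : EuclideanSpace ℝ (Fin d) → F} (hφ : AEStronglyMeasurable φ (uniformSphere d)) {C : ℝ}
    (hC : ∀ x, ‖x‖ = 1 → ‖φ x‖ ≤ C) : Integrable φ (uniformSphere d) := by
  have := isProbabilityMeasure_uniformSphere hd
  refine Integrable.of_bound hφ C ?_
  filter_upwards [ae_norm_eq_one_uniformSphere] with x hx using hC x hx

theorem integral_uniformSphere (d : ℕ) : ∫ x, x ∂(uniformSphere d) = 0 := by
  have h := (measurePreserving_uniformSphere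
    (LinearIsometryEquiv.neg ℝ (E := EuclideanSpace ℝ (Fin d)))).integral_comp
    (LinearIsometryEquiv.neg ℝ).toHomeomorph.measurableEmbedding (fun x => x)
  have h2 : -∫ x, x ∂(uniformSphere d) = ∫ x, x ∂(uniformSphere d) := by
    rw [← integral_neg]
    simpa using h
  have h3 : (2 : ℝ) • ∫ x, x ∂(uniformSphere d) = 0 := by
    rw [two_smul]
    nth_rewrite 1 [← h2]
    exact neg_add_cancel _
  exact (smul_eq_zero.mp h3).resolve_left two_ne_zero

/-- By symmetry, every component of a uniform vector on the sphere has second moment `1 / d`. -/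
theorem integral_inner_sq_uniformSphere (hd : 0 < d) {v : EuclideanSpace ℝ (Fin d)}
    (hv : ‖v‖ = 1) : ∫ x, (inner ℝ v x) ^ 2 ∂(uniformSphere d) = 1 / d := by
  have := isProbabilityMeasure_uniformSphere hd
  let b := EuclideanSpace.basisFun (Fin d) ℝ
  have hinv : ∀ i, ∫ x, (inner ℝ (b i) x) ^ 2 ∂(uniformSphere d)
      = ∫ x, (inner ℝ v x) ^ 2 ∂(uniformSphere d) := fun i => by
    let A := (Submodule.span ℝ {v - b i})ᗮ.reflection
    have hA : A v = b i := Submodule.reflection_sub (by rw [hv, b.norm_eq_one])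
    have h := (measurePreserving_uniformSphere A).integral_comp
      A.toHomeomorph.measurableEmbedding (fun x => (inner ℝ (b i) x) ^ 2)
    rw [← h]
    congr with x
    rw [← hA, A.inner_map_map]
  have hint : ∀ i, Integrable (fun x => (inner ℝ (b i) x) ^ 2) (uniformSphere d) := fun i => by
    refine integrable_uniformSphere hd
      ((Continuous.inner continuous_const continuous_id).pow 2).aestronglyMeasurable (C := 1)
      fun x hx => ?_
    rw [norm_pow, Real.norm_eq_abs]
    refine pow_le_one₀ (abs_nonneg _) ((abs_real_inner_le_norm _ _).trans ?_)
    rw [hx, b.norm_eq_one, one_mul]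
  have hsum : ∑ i, ∫ x, (inner ℝ (b i) x) ^ 2 ∂(uniformSphere d) = 1 := by
    rw [← integral_finsetSum _ fun i _ => hint i]
    have : ∀ᵐ x ∂(uniformSphere d), ∑ i, (inner ℝ (b i) x) ^ 2 = (1 : ℝ) := by
      filter_upwards [ae_norm_eq_one_uniformSphere] with x hx
      have := b.sum_sq_norm_inner_right x
      simp only [Real.norm_eq_abs, sq_abs] at this
      rw [this, hx, one_pow]
    rw [integral_congr_ae this]
    simp
  rw [Finset.sum_congr rfl fun i _ => hinv i] at hsum
  have hd' : (d : ℝ) ≠ 0 := by positivity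
  simp only [Finset.sum_const, Finset.card_univ, Fintype.card_fin, nsmul_eq_mul] at hsum
  field_simp
  linarith

end Sphere

/-! ### The randomness of the algorithm -/

section Algorithm

variable {d : ℕ} {f : EuclideanSpace ℝ (Fin d) → ℝ} {S : Type*} [MeasurableSpace S]
  {ν : Measure S} [IsProbabilityMeasure ν]
  {SG : EuclideanSpace ℝ (Fin d) → S → EuclideanSpace ℝ (Fin d)} {Q : ℝ}

/-- The total noise of one step: the error of the oracle and the artificial noise. -/
noncomputable def totalNoise (f : EuclideanSpace ℝ (Fin d) → ℝ)
    (SG : EuclideanSpace ℝ (Fin d) → S → EuclideanSpace ℝ (Fin d)) (w : EuclideanSpace ℝ (Fin d))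
    (x : S × EuclideanSpace ℝ (Fin d)) : EuclideanSpace ℝ (Fin d) :=
  (SG w x.1 - gradient f w) + x.2

theorem isNoise_totalNoise (hd : 0 < d) (hf : Continuous (gradient f))
    (h : IsStochasticGradientOracle f SG ν Q) {W : ℝ} (hQ : Q + 1 ≤ W) (hdW : d ≤ W) :
    IsNoise (ν.prod (uniformSphere d)) (totalNoise f SG) W := by
  have := isProbabilityMeasure_uniformSphere hd
  have hi1 : ∀ w, Integrable (fun x : S × EuclideanSpace ℝ (Fin d) => SG w x.1 - gradient f w)
      (ν.prod (uniformSphere d)) := fun w =>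
    ((h.integrable w).sub (integrable_const (gradient f w))).comp_fst _
  have hi2 : Integrable (fun x : EuclideanSpace ℝ (Fin d) => x) (uniformSphere d) :=
    integrable_uniformSphere hd continuous_id.aestronglyMeasurable (C := 1) fun x hx => hx.le
  have hm : Measurable (fun p : EuclideanSpace ℝ (Fin d) × (S × EuclideanSpace ℝ (Fin d)) =>
      (SG p.1 p.2.1 - gradient f p.1) + p.2.2) := by
    have h1 : Measurable (fun p : EuclideanSpace ℝ (Fin d) × (S × EuclideanSpace ℝ (Fin d)) =>
      SG p.1 p.2.1) := h.measurable.comp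
        (measurable_fst.prodMk (measurable_fst.comp measurable_snd))
    exact (h1.sub (hf.measurable.comp measurable_fst)).add (measurable_snd.comp measurable_snd)
  have hz : ∀ w, ∫ s, (SG w s - gradient f w) ∂ν = 0 := fun w => by
    rw [integral_sub (h.integrable w) (integrable_const _), h.mean]
    simp
  refine ⟨hm, fun w => ?_, fun w => ?_, fun w v hv => ?_⟩
  · have e1 : ∫ x, (SG w x.1 - gradient f w) ∂(ν.prod (uniformSphere d)) = 0 := by
      rw [integral_fun_fst (fun s => SG w s - gradient f w), hz, smul_zero]
    have e2 : ∫ x, x.2 ∂(ν.prod (uniformSphere d)) = 0 := by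
      rw [integral_fun_snd (fun x => x), integral_uniformSphere, smul_zero]
    unfold totalNoise
    rw [integral_add (hi1 w) (hi2.comp_snd ν), e1, e2, add_zero]
  · have h1 : ∀ᵐ x ∂(ν.prod (uniformSphere d)), ‖SG w x.1 - gradient f w‖ ≤ Q :=
      Measure.quasiMeasurePreserving_fst.ae (h.radius w)
    have h2 : ∀ᵐ x ∂(ν.prod (uniformSphere d)), ‖x.2‖ = 1 :=
      Measure.quasiMeasurePreserving_snd.ae ae_norm_eq_one_uniformSphere
    filter_upwards [h1, h2] with x hx1 hx2
    refine (norm_add_le _ _).trans ?_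
    rw [hx2]
    linarith
  · -- The oracle error and the artificial noise are independent and centred.
    set a : S → ℝ := fun s => inner ℝ v (SG w s - gradient f w) with ha
    set b : EuclideanSpace ℝ (Fin d) → ℝ := fun x => inner ℝ v x with hb
    have ia : Integrable a ν := ((h.integrable w).sub (integrable_const _)).const_inner v
    have ib : Integrable b (uniformSphere d) := hi2.const_inner v
    have ib2 : Integrable (fun x => b x ^ 2) (uniformSphere d) := by
      refine integrable_uniformSphere hd
        ((Continuous.inner continuous_const continuous_id).pow 2).aestronglyMeasurable (C := 1)
        fun x hx => ?_
      rw [norm_pow, Real.norm_eq_abs]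
      refine pow_le_one₀ (abs_nonneg _) ((abs_real_inner_le_norm _ _).trans ?_)
      rw [hx, hv, one_mul]
    have ha0 : ∫ s, a s ∂ν = 0 := by
      have := integral_inner (𝕜 := ℝ) ((h.integrable w).sub (integrable_const (gradient f w))) v
      simp only [Pi.sub_apply] at this
      rw [ha, this, hz, inner_zero_right]
    have iab : Integrable (fun x : S × EuclideanSpace ℝ (Fin d) => a x.1 * b x.2)
        (ν.prod (uniformSphere d)) := ia.mul_prod ib
    have iab2 : Integrable (fun x : S × EuclideanSpace ℝ (Fin d) => b x.2 ^ 2)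
        (ν.prod (uniformSphere d)) := ib2.comp_snd ν
    have i2 : Integrable (fun x => (inner ℝ v (totalNoise f SG w x)) ^ 2)
        (ν.prod (uniformSphere d)) := by
      refine Integrable.of_bound (C := (Q + 1) ^ 2) ?_ ?_
      · have : Measurable (totalNoise f SG w) := hm.comp measurable_prodMk_left
        exact ((measurable_const.inner this).pow_const 2).aestronglyMeasurable
      · have h1 : ∀ᵐ x ∂(ν.prod (uniformSphere d)), ‖SG w x.1 - gradient f w‖ ≤ Q :=
          Measure.quasiMeasurePreserving_fst.ae (h.radius w)
        have h2 : ∀ᵐ x ∂(ν.prod (uniformSphere d)), ‖x.2‖ = 1 :=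
          Measure.quasiMeasurePreserving_snd.ae ae_norm_eq_one_uniformSphere
        filter_upwards [h1, h2] with x hx1 hx2
        rw [norm_pow, Real.norm_eq_abs]
        gcongr
        refine (abs_real_inner_le_norm _ _).trans ?_
        rw [hv, one_mul]
        refine (norm_add_le _ _).trans ?_
        rw [hx2]
        linarith
    have hle := integral_mono ((iab.const_mul 2).add iab2) i2 (fun x => by
      have e : inner ℝ v (totalNoise f SG w x) = a x.1 + b x.2 := by
        rw [totalNoise, inner_add_right]
      simp only [Pi.add_apply, e]
      nlinarith [sq_nonneg (a x.1)])
    simp only [Pi.add_apply] at hle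
    rw [integral_add (iab.const_mul 2) iab2, integral_const_mul, integral_prod_mul a b, ha0,
      integral_fun_snd (fun x => b x ^ 2), integral_inner_sq_uniformSphere hd hv] at hle
    simp only [zero_mul, mul_zero, zero_add, probReal_univ, one_smul] at hle
    refine le_trans ?_ hle
    have : (0 : ℝ) < d := by exact_mod_cast hd
    gcongr

theorem noisyStep_totalNoise (η : ℝ) (w : EuclideanSpace ℝ (Fin d))
    (x : S × EuclideanSpace ℝ (Fin d)) :
    noisyStep η (gradient f) (totalNoise f SG) w x = w - η • (SG w x.1 + x.2) := by
  rw [noisyStep, totalNoise]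
  module

theorem measurable_iterate (hSG : Measurable (Function.uncurry SG)) (η : ℝ)
    (w₀ : EuclideanSpace ℝ (Fin d)) (n : ℕ) :
    Measurable (fun x : ℕ → S × EuclideanSpace ℝ (Fin d) => iterate η SG w₀ x n) := by
  induction n with
  | zero => exact measurable_const
  | succ n ih =>
    have h1 : Measurable (fun x : ℕ → S × EuclideanSpace ℝ (Fin d) =>
        SG (iterate η SG w₀ x n) (x n).1) :=
      hSG.comp (ih.prodMk (measurable_fst.comp (measurable_pi_apply n)))
    exact ih.sub ((h1.add (measurable_snd.comp (measurable_pi_apply n))).const_smul η)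

theorem iterate_congr (η : ℝ) (w₀ : EuclideanSpace ℝ (Fin d)) {n : ℕ}
    {x y : ℕ → S × EuclideanSpace ℝ (Fin d)} (h : ∀ i < n, x i = y i) :
    iterate η SG w₀ x n = iterate η SG w₀ y n := by
  induction n with
  | zero => rfl
  | succ n ih =>
    simp only [iterate]
    rw [ih fun i hi => h i (by omega), h n (by omega)]

variable {Ω : Type*} [MeasurableSpace Ω] {P : Measure Ω} [IsProbabilityMeasure P]
  {X : ℕ → Ω → S × EuclideanSpace ℝ (Fin d)}

/-- The `n`-th iterate depends on the first `n` inputs only, hence is independent of the next. -/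
theorem indepFun_iterate (hSG : Measurable (Function.uncurry SG))
    (hX : IsAlgorithmRandomness ν P X) (η : ℝ) (w₀ : EuclideanSpace ℝ (Fin d)) (n : ℕ) :
    IndepFun (fun ω => iterate η SG w₀ (fun t => X t ω) n) (X n) P := by
  obtain ⟨ω₀⟩ : Nonempty Ω := nonempty_of_isProbabilityMeasure P
  have h1 := hX.indep.indepFun_finset (Finset.range n) {n} (by simp) hX.measurable
  let ext : (Finset.range n → S × EuclideanSpace ℝ (Fin d)) → ℕ → S × EuclideanSpace ℝ (Fin d) :=
    fun y i => if hi : i ∈ Finset.range n then y ⟨i, hi⟩ else X i ω₀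
  have hext : Measurable ext := by
    refine measurable_pi_lambda _ fun i => ?_
    by_cases hi : i ∈ Finset.range n
    · simp only [ext, dif_pos hi]
      exact measurable_pi_apply _
    · simp only [ext, dif_neg hi]
      exact measurable_const
  have h2 := h1.comp ((measurable_iterate hSG η w₀ n).comp hext)
    (measurable_pi_apply (⟨n, by simp⟩ : ({n} : Finset ℕ)))
  have e : (fun ω => iterate η SG w₀ (fun t => X t ω) n)
      = ((fun x => iterate η SG w₀ x n) ∘ ext) ∘ fun ω (i : Finset.range n) => X i ω := by
    funext ω
    refine iterate_congr η w₀ fun i hi => ?_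
    simp [ext, hi]
  rw [e]
  exact h2

/-- The law of the `n`-th iterate is given by the `n`-th power of the transition operator. -/
theorem integral_iterate (hd : 0 < d) (hf : Continuous (gradient f))
    (h : IsStochasticGradientOracle f SG ν Q) (hX : IsAlgorithmRandomness ν P X) (η : ℝ)
    (w₀ : EuclideanSpace ℝ (Fin d)) {C : ℝ} (n : ℕ) {φ : EuclideanSpace ℝ (Fin d) → ℝ}
    (hφ : Measurable φ) (hC : ∀ w, |φ w| ≤ C) :
    ∫ ω, φ (iterate η SG w₀ (fun t => X t ω) n) ∂P
      = (transition (ν.prod (uniformSphere d))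
          (noisyStep η (gradient f) (totalNoise f SG)))^[n] φ w₀ := by
  have := isProbabilityMeasure_uniformSphere hd
  have hstep := (isNoise_totalNoise hd hf h (W := max (Q + 1) d) (le_max_left _ _)
    (le_max_right _ _)).locBddStep hf η
  set F := noisyStep η (gradient f) (totalNoise f SG) with hF
  induction n generalizing φ with
  | zero => simp [iterate]
  | succ n ih =>
    have hB := (LocBdd.of_bounded hφ hC).of_transition hstep
    have hIcc := transition_mem_Icc hstep (LocBdd.of_bounded hφ hC) (fun w => abs_le.mp (hC w))
    rw [Function.iterate_succ_apply, ← ih hB.measurable (fun w => abs_le.mpr (hIcc w))]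
    have hm : Measurable (fun ω => iterate η SG w₀ (fun t => X t ω) n) :=
      (measurable_iterate h.measurable η w₀ n).comp (measurable_pi_lambda _ hX.measurable)
    have hlaw := (indepFun_iterate h.measurable hX η w₀ n).map_prod_eq_prod_map_map
      hm.aemeasurable (hX.measurable n).aemeasurable
    rw [hX.law] at hlaw
    have hφF : Measurable (fun p : EuclideanSpace ℝ (Fin d) × (S × EuclideanSpace ℝ (Fin d)) =>
      φ (F p.1 p.2)) := hφ.comp hstep.measurable
    have : IsProbabilityMeasure (P.map (fun ω => iterate η SG w₀ (fun t => X t ω) n)) :=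
      Measure.isProbabilityMeasure_map hm.aemeasurable
    calc ∫ ω, φ (iterate η SG w₀ (fun t => X t ω) (n + 1)) ∂P
        = ∫ ω, φ (F (iterate η SG w₀ (fun t => X t ω) n) (X n ω)) ∂P := by
          simp only [iterate, hF, noisyStep_totalNoise]
      _ = ∫ p, φ (F p.1 p.2) ∂(P.map fun ω => (iterate η SG w₀ (fun t => X t ω) n, X n ω)) :=
          (integral_map (hm.prodMk (hX.measurable n)).aemeasurable
            hφF.aestronglyMeasurable).symm
      _ = ∫ w, ∫ x, φ (F w x) ∂(ν.prod (uniformSphere d))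
            ∂(P.map fun ω => iterate η SG w₀ (fun t => X t ω) n) := by
          rw [hlaw, integral_prod _ (Integrable.of_bound hφF.aestronglyMeasurable C
            (.of_forall fun p => hC _))]
      _ = _ := integral_map hm.aemeasurable hB.measurable.aestronglyMeasurable

end Algorithm

/-! ### The size of the parameters -/

/-- One number which dominates all the parameters of the problem and their relevant inverses. Since
it is at least `2`, numerical constants are absorbed into its powers. -/
noncomputable def Params.size (p : Params) : ℝ := 1 + ∑ i, p.vec i

theorem Params.size_eq (p : Params) : p.size =
    1 + (p.Q + 1 / p.α + 1 / p.γ + 1 / p.ε + 1 / p.δ + p.B + p.β + p.ρ + p.d) := by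
  simp [Params.size, Params.vec, Fin.sum_univ_succ]
  ring

theorem isOTildeOne_size_pow (n : ℕ) : IsOTildeOne (fun p => p.size ^ n) :=
  ⟨(1 + ∑ i, MvPolynomial.X i) ^ n, fun p _ => by simp [Params.size]⟩

theorem Params.Valid.bounds {p : Params} (hp : p.Valid) :
    2 ≤ p.size ∧ p.Q + 1 ≤ p.size ∧ 1 / p.size ≤ p.α ∧ 1 / p.size ≤ p.γ ∧ 1 / p.size ≤ p.ε ∧
      1 / p.size ≤ p.δ ∧ p.B ≤ p.size ∧ p.β ≤ p.size ∧ p.ρ ≤ p.size ∧ p.d ≤ p.size := by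
  obtain ⟨hd, hQ, hα, hγ, hε, hδ, hB, hβ, hρ⟩ := hp
  have hd1 : (1 : ℝ) ≤ p.d := by exact_mod_cast hd
  have hα' := one_div_pos.mpr hα
  have hγ' := one_div_pos.mpr hγ
  have hε' := one_div_pos.mpr hε
  have hδ' := one_div_pos.mpr hδ
  have hinv : ∀ x : ℝ, 0 < x → 1 / x ≤ p.size → 1 / p.size ≤ x := fun x hx h =>
    (one_div_le ((one_div_pos.mpr hx).trans_le h) hx).mpr h
  have hs := p.size_eq
  refine ⟨?_, ?_, hinv _ hα ?_, hinv _ hγ ?_, hinv _ hε ?_, hinv _ hδ ?_, ?_, ?_, ?_, ?_⟩ <;>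
    linarith

section Main

variable {d : ℕ} {f : EuclideanSpace ℝ (Fin d) → ℝ} {S Ω : Type*} [MeasurableSpace S]
  [MeasurableSpace Ω] {ν : Measure S} [IsProbabilityMeasure ν] {P : Measure Ω}
  [IsProbabilityMeasure P] {SG : EuclideanSpace ℝ (Fin d) → S → EuclideanSpace ℝ (Fin d)}
  {X : ℕ → Ω → S × EuclideanSpace ℝ (Fin d)} {Q W η δ ζ : ℝ}

/-- The failure bound for the transition operator, transported to the algorithm. -/
theorem le_prob_near_localMin (hd : 0 < d) (hSG : IsStochasticGradientOracle f SG ν Q)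
    (hX : IsAlgorithmRandomness ν P X)
    (h : IsNoisyDescent f (ν.prod (uniformSphere d)) (totalNoise f SG) W η) (hδ : 1 / W ≤ δ)
    (hf : ∀ w, |f w| ≤ W)
    (hcover : ∀ w, 1 / W ≤ ‖gradient f w‖ ∨ LambdaMinLE (hessian f w) (-(1 / W)) ∨
      ∃ wstar, IsLocalMin f wstar ∧ ‖w - wstar‖ ≤ δ ∧
        StronglyConvexOn f (1 / W) (Metric.closedBall wstar (2 * δ)))
    (hζ : 0 < ζ) (hζ1 : ζ < 1) (hsmall : η * W ^ 100 * max 1 (Real.log (1 / ζ)) ≤ 1)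
    (w₀ : EuclideanSpace ℝ (Fin d)) :
    1 - ζ ≤ P.real {ω | ∃ wstar, IsLocalMin f wstar ∧
      ‖iterate η SG w₀ (fun t => X t ω) ⌈W ^ 8 * (η ^ 2)⁻¹ * max 1 (Real.log (1 / ζ))⌉₊ - wstar‖
        ≤ W ^ 6 * √(η * Real.log (1 / (η * ζ)))} := by
  have := isProbabilityMeasure_uniformSphere hd
  set T := ⌈W ^ 8 * (η ^ 2)⁻¹ * max 1 (Real.log (1 / ζ))⌉₊
  set r := W ^ 6 * √(η * Real.log (1 / (η * ζ))) with hr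
  -- The strict inequality makes this set open, hence measurable.
  set A := Metric.thickening r {wstar | IsLocalMin f wstar} with hA
  have hAm : MeasurableSet A := Metric.isOpen_thickening.measurableSet
  have hmem : ∀ w, w ∈ A ↔ ∃ wstar, IsLocalMin f wstar ∧ ‖w - wstar‖ < r := fun w => by
    simp [hA, Metric.mem_thickening_iff, dist_eq_norm]
  set χ : EuclideanSpace ℝ (Fin d) → ℝ := Aᶜ.indicator 1 with hχ
  have hind : IsIndicator χ := ⟨measurable_one.indicator hAm.compl, fun w => by
    by_cases hw : w ∈ A <;> simp [hχ, hw]⟩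
  have h1 := iterate_failure_le h hδ hf hcover hζ hζ1 hsmall hind.locBdd hind.le_one
    (fun w wstar hmin hw => by
      have : w ∈ A := (hmem w).mpr ⟨wstar, hmin, hw⟩
      simp [hχ, this]) w₀
  rw [← integral_iterate hd h.differentiable_gradient.continuous hSG hX η w₀ T hind.measurable
    (C := 1) (fun w => abs_le.mpr ⟨by linarith [hind.nonneg w], hind.le_one w⟩)] at h1
  have hm : Measurable (fun ω => iterate η SG w₀ (fun t => X t ω) T) :=
    (measurable_iterate hSG.measurable η w₀ T).comp (measurable_pi_lambda _ hX.measurable)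
  set G := (fun ω => iterate η SG w₀ (fun t => X t ω) T) ⁻¹' A with hG
  have hGm : MeasurableSet G := hm hAm
  have h2 : ∫ ω, χ (iterate η SG w₀ (fun t => X t ω) T) ∂P = P.real Gᶜ := by
    rw [← integral_indicator_one hGm.compl]
    rfl
  rw [h2, probReal_compl_eq_one_sub hGm] at h1
  calc 1 - ζ ≤ P.real G := by linarith
    _ ≤ _ := measureReal_mono fun ω hω => by
      obtain ⟨wstar, hmin, hlt⟩ := (hmem _).mp hω
      exact ⟨wstar, hmin, hlt.le⟩

end Main

end NoisySGD

theorem theorem1 :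
    ∃ ηmax K R : NoisySGD.Params → ℝ,
      NoisySGD.IsThetaTildeOne ηmax ∧ NoisySGD.IsOTildeOne K ∧ NoisySGD.IsOTildeOne R ∧
      ∀ p : NoisySGD.Params, p.Valid →
      ∀ f : EuclideanSpace ℝ (Fin p.d) → ℝ,
        NoisySGD.IsStrictSaddle f p.α p.γ p.ε p.δ →
        (∀ w, |f w| ≤ p.B) →
        NoisySGD.IsSmooth f p.β →
        NoisySGD.HasLipschitzHessian f p.ρ →
      ∀ (S : Type*) [MeasurableSpace S] (ν : Measure S) [IsProbabilityMeasure ν]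
        (SG : EuclideanSpace ℝ (Fin p.d) → S → EuclideanSpace ℝ (Fin p.d)),
        NoisySGD.IsStochasticGradientOracle f SG ν p.Q →
      ∀ (Ω : Type*) [MeasurableSpace Ω] (P : Measure Ω) [IsProbabilityMeasure P]
        (X : ℕ → Ω → S × EuclideanSpace ℝ (Fin p.d)),
        NoisySGD.IsAlgorithmRandomness ν P X →
      ∀ w₀ : EuclideanSpace ℝ (Fin p.d),
      ∀ ζ : ℝ, 0 < ζ →
      ∀ η : ℝ, 0 < η → η ≤ ηmax p / max 1 (Real.log (1 / ζ)) →
      ∀ T : ℕ, T = ⌈K p * (η ^ 2)⁻¹ * max 1 (Real.log (1 / ζ))⌉₊ →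
        1 - ζ ≤ P.real {ω | ∃ wstar, IsLocalMin f wstar ∧
          ‖NoisySGD.iterate η SG w₀ (fun t => X t ω) T - wstar‖
            ≤ R p * √(η * Real.log (1 / (η * ζ)))} := by
  refine ⟨fun p => 1 / p.size ^ 100, fun p => p.size ^ 8, fun p => p.size ^ 6,
    ⟨fun p hp => ?_, ⟨1, fun p hp => ?_⟩, ?_⟩, NoisySGD.isOTildeOne_size_pow 8,
    NoisySGD.isOTildeOne_size_pow 6, ?_⟩
  · have := hp.bounds.1
    positivity
  · rw [map_one]
    exact div_le_one_of_le₀ (one_le_pow₀ (by linarith [hp.bounds.1])) (by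
      have := hp.bounds.1
      positivity)
  · simpa using NoisySGD.isOTildeOne_size_pow 100
  intro p hp f hsad hB hsmooth hhess S _ ν _ SG hSG Ω _ P _ X hX w₀ ζ hζ η hη hηmax T hT
  obtain ⟨hW, hQ, hα, hγ, hε, hδ, hBW, hβ, hρ, hd⟩ := hp.bounds
  have hW0 : 0 < p.size := by linarith
  rcases le_or_gt 1 ζ with hζ1 | hζ1
  · exact le_trans (by linarith) measureReal_nonneg
  have hl : 1 ≤ max 1 (Real.log (1 / ζ)) := le_max_left _ _
  have hsmall : η * p.size ^ 100 * max 1 (Real.log (1 / ζ)) ≤ 1 := by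
    rw [div_div, le_div_iff₀ (by positivity)] at hηmax
    linarith
  have hdesc : NoisySGD.IsNoisyDescent f (ν.prod (NoisySGD.uniformSphere p.d))
      (NoisySGD.totalNoise f SG) p.size η :=
    { differentiable := hsad.differentiable
      differentiable_gradient := hsad.differentiable_gradient
      smooth := fun w₁ w₂ => (hsmooth w₁ w₂).trans (by gcongr)
      hessian_lipschitz := fun w₁ w₂ => (hhess w₁ w₂).trans (by gcongr)
      noise := NoisySGD.isNoise_totalNoise hp.d_pos hsad.differentiable_gradient.continuous hSG
        hQ hd
      two_le := hW
      step_pos := hη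
      step_small := (le_mul_of_one_le_right (by positivity) hl).trans hsmall }
  subst hT
  refine NoisySGD.le_prob_near_localMin hp.d_pos hSG hX hdesc hδ (fun w => (hB w).trans hBW)
    (fun w => ?_) hζ hζ1 hsmall w₀
  rcases hsad.trichotomy w with h | ⟨l, hl, he⟩ | ⟨wstar, hmin, hd, hconv⟩
  · exact Or.inl (hε.trans h)
  · exact Or.inr (Or.inl ⟨l, by linarith, he⟩)
  · exact Or.inr (Or.inr ⟨wstar, hmin, hd, fun w hw l hl => hα.trans (hconv w hw l hl)⟩)
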